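/- Let $k$ be a field, let $n\ge 0$ and $N\ge 2$ be integers, let $V=k^n$ with canonical basis $e_1,\dots,e_n$, let $E:V^{\otimes N}\to k$ be a linear map and write $E(i_1,\dots,i_N)=E(e_{i_1}\otimes\cdots\otimes e_{i_N})$. Assume that $E$ is left and right non-degenerate, i.e. that both linear maps $V^{\otimes (N-1)}\to V^*$, $x\mapsto E(x\otimes -)$ and $x\mapsto E(-\otimes x)$, are surjective. Let $SL(E)$ be the universal unital associative $k$-algebra with generators $a_{ij}$ $(1\le i,j\le n)$ and relations $$\sum_{j_1,\dots,j_N}E(j_1,\dots,j_N)\,a_{j_1i_1}\cdots a_{j_Ni_N}=E(i_1,\dots,i_N)\,1,\qquad \sum_{j_1,\dots,j_N}E(j_1,\dots,j_N)\,a_{i_1j_1}\cdots a_{i_Nj_N}=E(i_1,\dots,i_N)\,1$$ for all $1\le i_1,\dots,i_N\le n$, with the bialgebra structure determined by $\Delta(a_{ij})=\sum_l a_{il}\otimes a_{lj}$ and $\varepsilon(a_{ij})=\delta_{ij}$. (i) $SL(E)$ is a Hopf algebra with bijective antipode $S$. (ii) If there are invertible scalars $\beta_1,\dots,\beta_n\in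 k^*$ such that $E(j_1,\dots,j_{N-1},i)=\beta_i\,E(i,j_1,\dots,j_{N-1})$ for all $i,j_1,\dots,j_{N-1}$, then there is an algebra morphism $\Phi_\beta:SL(E)\to k$ with $\Phi_\beta(a_{ij})=\delta_{ij}\beta_i$, and it is a sovereign character, i.e. $S^{-1}=\Phi_\beta * S * \Phi_\beta^{-1}$ for the convolution product, $\Phi_\beta^{-1}$ being the convolution inverse of $\Phi_\beta$. (iii) If $k$ has characteristic zero and the subfield $\mathbb Q\bigl(E(j_1,\dots,j_N) : 1\le j_1,\dots,j_N\le n\bigr)$ of $k$ can be ordered (made into an ordered field), then $SL(E)$ is cosemisimple, i.e. it is the sum of its simple subcoalgebras. (iv) If $k=\mathbb C$ and $E(j_1,\dots,j_N)\in\mathbb R$ for all $j_1,\dots,j_N$, then $SL(E)$ admits a CQG algebra structure: there is a $*$-algebra structure on $SL(E)$ for which $\Delta$ is a $*$-homomorphism and such that, for every $m$ and every matrix $x=(x_{ij})\in M_m(SL(E))$ with $\Delta(x_{ij})=\sum_l x_{il}\otimes x_{lj}$ and $\varepsilon(x_{ij})=\delta_{ij}$, there is $F\in GL_m(\mathbb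 C)$ such that $FxF^{-1}$ is unitary. -/

import Mathlib

open scoped TensorProduct
open Coalgebra HopfAlgebra

namespace Cosovereign

universe u v

/-! ### Forms on tensor powers of `V = k ^ n` -/

section Forms

variable {k : Type u} [Field k] {n M : ℕ}

/-- A linear form on the `N`-th tensor power of `V = k ^ n`. -/
abbrev Form (k : Type u) [Field k] (n N : ℕ) : Type u :=
  (⨂[k] _ : Fin N, (Fin n → k)) →ₗ[k] k

/-- The scalar `E(i₁, …, i_N) = E(e_{i₁} ⊗ ⋯ ⊗ e_{i_N})`. -/
noncomputable def Form.coeff {N : ℕ} (E : Form k n N) (i : Fin N → Fin n) : k :=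
  E (PiTensorProduct.tprod k fun t => Pi.single (i t) 1)

/-- The linear map `V^{⊗ M} → V*`, `x ↦ (v ↦ E(x ⊗ v))`, for a form `E` on `V^{⊗ (M+1)}`. -/
noncomputable def Form.leftMap (E : Form k n (M + 1)) :
    (⨂[k] _ : Fin M, (Fin n → k)) →ₗ[k] Module.Dual k (Fin n → k) :=
  PiTensorProduct.lift (E.compMultilinearMap (PiTensorProduct.tprod k)).curryRight

/-- The linear map `V^{⊗ M} → V*`, `x ↦ (v ↦ E(v ⊗ x))`, for a form `E` on `V^{⊗ (M+1)}`. -/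
noncomputable def Form.rightMap (E : Form k n (M + 1)) :
    (⨂[k] _ : Fin M, (Fin n → k)) →ₗ[k] Module.Dual k (Fin n → k) :=
  ((PiTensorProduct.lift (R := k) (s := fun _ : Fin M => Fin n → k) (E := k)).toLinearMap ∘ₗ
    (E.compMultilinearMap (PiTensorProduct.tprod k)).curryLeft).flip

/-- Left non-degeneracy: `x ↦ E(x ⊗ -)` is onto `V*`. -/
def Form.LeftNondegenerate (E : Form k n (M + 1)) : Prop :=
  Function.Surjective E.leftMap

/-- Right non-degeneracy: `x ↦ E(- ⊗ x)` is onto `V*`. -/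
def Form.RightNondegenerate (E : Form k n (M + 1)) : Prop :=
  Function.Surjective E.rightMap

end Forms

/-! ### The algebra `SL(E)` -/

section SL

variable {k : Type u} [Field k] {n N : ℕ}

/-- The defining relations of `SL(E)` on the free algebra on generators `x_{ij}`:
`∑_j E(j₁,…,j_N) x_{j₁ i₁} ⋯ x_{j_N i_N} = E(i₁,…,i_N)` and
`∑_j E(j₁,…,j_N) x_{i₁ j₁} ⋯ x_{i_N j_N} = E(i₁,…,i_N)`. -/
inductive SL.Rel (E : Form k n N) :
    FreeAlgebra k (Fin n × Fin n) → FreeAlgebra k (Fin n × Fin n) → Prop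
  | col (i : Fin N → Fin n) : SL.Rel E
      (∑ j : Fin N → Fin n,
        E.coeff j • (List.ofFn fun t => FreeAlgebra.ι k (j t, i t)).prod)
      (E.coeff i • 1)
  | row (i : Fin N → Fin n) : SL.Rel E
      (∑ j : Fin N → Fin n,
        E.coeff j • (List.ofFn fun t => FreeAlgebra.ι k (i t, j t)).prod)
      (E.coeff i • 1)

/-- The universal algebra with generators `a_{ij}` and the relations `SL.Rel E`. -/
def SL (E : Form k n N) : Type u := RingQuot (SL.Rel E)

namespace SL

variable (E : Form k n N)

noncomputable instance : Ring (SL E) := inferInstanceAs (Ring (RingQuot (SL.Rel E)))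

noncomputable instance : Algebra k (SL E) := inferInstanceAs (Algebra k (RingQuot (SL.Rel E)))

/-- The generator `a_{ij}` of `SL(E)`. -/
noncomputable def a (i j : Fin n) : SL E :=
  (RingQuot.mkAlgHom k (SL.Rel E) : _ →ₐ[k] SL E) (FreeAlgebra.ι k (i, j))

theorem col_rel (i : Fin N → Fin n) :
    ∑ j : Fin N → Fin n, E.coeff j • (List.ofFn fun t => a E (j t) (i t)).prod
      = E.coeff i • 1 := by
  have h := RingQuot.mkAlgHom_rel k (SL.Rel.col (E := E) i)
  simp only [map_sum, map_smul, map_list_prod, List.map_ofFn, Function.comp_def, map_one] at h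
  exact h

theorem row_rel (i : Fin N → Fin n) :
    ∑ j : Fin N → Fin n, E.coeff j • (List.ofFn fun t => a E (i t) (j t)).prod
      = E.coeff i • 1 := by
  have h := RingQuot.mkAlgHom_rel k (SL.Rel.row (E := E) i)
  simp only [map_sum, map_smul, map_list_prod, List.map_ofFn, Function.comp_def, map_one] at h
  exact h

variable {E}

/-- The universal property of `SL(E)`. -/
noncomputable def lift {B : Type v} [Ring B] [Algebra k B] (b : Fin n → Fin n → B)
    (hcol : ∀ i : Fin N → Fin n,
      ∑ j : Fin N → Fin n, E.coeff j • (List.ofFn fun t => b (j t) (i t)).prod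
        = E.coeff i • 1)
    (hrow : ∀ i : Fin N → Fin n,
      ∑ j : Fin N → Fin n, E.coeff j • (List.ofFn fun t => b (i t) (j t)).prod
        = E.coeff i • 1) : SL E →ₐ[k] B :=
  RingQuot.liftAlgHom k ⟨FreeAlgebra.lift k fun p => b p.1 p.2, by
    rintro _ _ (i | i)
    · simpa [map_sum, map_list_prod, List.map_ofFn, Function.comp_def] using hcol i
    · simpa [map_sum, map_list_prod, List.map_ofFn, Function.comp_def] using hrow i⟩

@[simp]
theorem lift_a {B : Type v} [Ring B] [Algebra k B] (b : Fin n → Fin n → B) (hcol) (hrow)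
    (i j : Fin n) : lift (E := E) b hcol hrow (a E i j) = b i j := by
  refine (RingQuot.liftAlgHom_mkAlgHom_apply k _ _ _).trans ?_
  simp

theorem algHom_ext {B : Type v} [Semiring B] [Algebra k B] {f g : SL E →ₐ[k] B}
    (h : ∀ i j, f (a E i j) = g (a E i j)) : f = g := by
  refine RingQuot.ringQuot_ext' k f g (FreeAlgebra.hom_ext ?_)
  funext p
  exact h p.1 p.2

theorem prod_ofFn_sum {B : Type v} [Ring B] [Algebra k B] (b : Fin N → Fin n → B) :
    (List.ofFn fun t => ∑ l, b t l).prod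
      = ∑ r : Fin N → Fin n, (List.ofFn fun t => b t (r t)).prod := by
  simpa using (MultilinearMap.mkPiAlgebraFin k N B).map_sum (α := fun _ => Fin n) b

theorem prod_ofFn_tmul {A B : Type*} [Ring A] [Algebra k A] [Ring B] [Algebra k B] {m : ℕ}
    (x : Fin m → A) (y : Fin m → B) :
    (List.ofFn fun t => x t ⊗ₜ[k] y t).prod
      = (List.ofFn x).prod ⊗ₜ[k] (List.ofFn y).prod := by
  induction m with
  | zero => simp [Algebra.TensorProduct.one_def]
  | succ m ih => simp [List.ofFn_succ, ih]

theorem comul_col (i : Fin N → Fin n) :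
    ∑ j : Fin N → Fin n, E.coeff j •
      (List.ofFn fun t => ∑ l, a E (j t) l ⊗ₜ[k] a E l (i t)).prod
        = E.coeff i • (1 : SL E ⊗[k] SL E) := by
  have h (j : Fin N → Fin n) :=
    prod_ofFn_sum (k := k) (fun t l => a E (j t) l ⊗ₜ[k] a E l (i t))
  simp_rw [h, prod_ofFn_tmul, Finset.smul_sum]
  rw [Finset.sum_comm]
  simp_rw [TensorProduct.smul_tmul', ← TensorProduct.sum_tmul, col_rel,
    TensorProduct.smul_tmul, ← TensorProduct.tmul_sum, col_rel, TensorProduct.tmul_smul,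
    Algebra.TensorProduct.one_def]

theorem comul_row (i : Fin N → Fin n) :
    ∑ j : Fin N → Fin n, E.coeff j •
      (List.ofFn fun t => ∑ l, a E (i t) l ⊗ₜ[k] a E l (j t)).prod
        = E.coeff i • (1 : SL E ⊗[k] SL E) := by
  have h (j : Fin N → Fin n) :=
    prod_ofFn_sum (k := k) (fun t l => a E (i t) l ⊗ₜ[k] a E l (j t))
  simp_rw [h, prod_ofFn_tmul, Finset.smul_sum]
  rw [Finset.sum_comm]
  simp_rw [← TensorProduct.tmul_smul, ← TensorProduct.tmul_sum, row_rel,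
    ← TensorProduct.smul_tmul, ← TensorProduct.sum_tmul, row_rel, ← TensorProduct.smul_tmul',
    Algebra.TensorProduct.one_def]

theorem prod_ofFn_delta {m : ℕ} (i j : Fin m → Fin n) :
    (List.ofFn fun t => if i t = j t then (1 : k) else 0).prod = if i = j then 1 else 0 := by
  rw [List.prod_ofFn, Finset.prod_ite_zero]
  simp [funext_iff]

variable (E)

/-- The comultiplication `Δ(a_{ij}) = ∑_l a_{il} ⊗ a_{lj}`. -/
noncomputable def comulHom : SL E →ₐ[k] SL E ⊗[k] SL E :=
  lift (fun i j => ∑ l, a E i l ⊗ₜ[k] a E l j) comul_col comul_row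

/-- The counit `ε(a_{ij}) = δ_{ij}`. -/
noncomputable def counitHom : SL E →ₐ[k] k :=
  lift (fun i j => if i = j then 1 else 0)
    (fun i => by simp [prod_ofFn_delta]) (fun i => by simp [prod_ofFn_delta])

/-- The bialgebra structure of `SL(E)`. -/
noncomputable instance : Bialgebra k (SL E) :=
  Bialgebra.ofAlgHom (comulHom E) (counitHom E)
    (by
      refine algHom_ext fun i j => ?_
      simp only [comulHom, AlgHom.comp_apply, lift_a, map_sum,
        Algebra.TensorProduct.map_tmul, AlgHom.coe_id, id_eq, TensorProduct.sum_tmul,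
        TensorProduct.tmul_sum]
      rw [Finset.sum_comm]
      simp)
    (by
      refine algHom_ext fun i j => ?_
      simp [comulHom, counitHom, TensorProduct.ite_tmul])
    (by
      refine algHom_ext fun i j => ?_
      simp [comulHom, counitHom, TensorProduct.tmul_ite])

theorem comul_a (i j : Fin n) :
    comul (R := k) (a E i j) = ∑ l, a E i l ⊗ₜ[k] a E l j :=
  lift_a _ _ _ i j

theorem counit_a (i j : Fin n) :
    counit (R := k) (a E i j) = if i = j then 1 else 0 :=
  lift_a _ _ _ i j

end SL

end SL

/-! ### Hopf algebra notions -/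

section Hopf

/-- `S` is an antipode of the bialgebra `A`: a two-sided convolution inverse of the identity. -/
structure IsAntipode (k : Type u) {A : Type v} [Field k] [Ring A] [Bialgebra k A]
    (S : A →ₗ[k] A) : Prop where
  left : LinearMap.mul' k A ∘ₗ S.rTensor A ∘ₗ comul = Algebra.linearMap k A ∘ₗ counit
  right : LinearMap.mul' k A ∘ₗ S.lTensor A ∘ₗ comul = Algebra.linearMap k A ∘ₗ counit

/-- The Hopf algebra given by a bialgebra and an antipode of it. -/
abbrev IsAntipode.hopfAlgebra {k : Type u} {A : Type v} [Field k] [Ring A] [Bialgebra k A]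
    {S : A →ₗ[k] A} (hS : IsAntipode k S) : HopfAlgebra k A where
  antipode := S
  mul_antipode_rTensor_comul := hS.left
  mul_antipode_lTensor_comul := hS.right

/-- A sovereign character on a Hopf algebra with bijective antipode `S`: an algebra morphism
`Φ : A → k` with `S⁻¹ = Φ * S * Φ⁻¹` for the convolution product, scalars being viewed in `A`
through the unit map. Here `Ψ` is the convolution inverse `Φ⁻¹` and `T` is the inverse map
`S⁻¹`. -/
def IsSovereignCharacter {k : Type u} {A : Type v} [Field k] [Ring A] [HopfAlgebra k A]
    (Φ : A →ₐ[k] k) : Prop :=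
  ∃ (Ψ : A →ₗ[k] k) (T : A →ₗ[k] A),
    (WithConv.toConv Φ.toLinearMap * WithConv.toConv Ψ = 1 ∧
      WithConv.toConv Ψ * WithConv.toConv Φ.toLinearMap = 1) ∧
    (T ∘ₗ antipode k = LinearMap.id ∧ antipode k ∘ₗ T = LinearMap.id) ∧
    WithConv.toConv T =
      WithConv.toConv (Algebra.linearMap k A ∘ₗ Φ.toLinearMap) *
        WithConv.toConv (antipode k) *
        WithConv.toConv (Algebra.linearMap k A ∘ₗ Ψ)

/-- A subspace `D` of a coalgebra is a subcoalgebra if `Δ(D) ⊆ D ⊗ D`. -/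
def IsSubcoalgebra {k : Type u} {C : Type v} [Field k] [AddCommGroup C] [Module k C]
    [Coalgebra k C] (D : Submodule k C) : Prop :=
  ∀ x ∈ D, comul (R := k) x ∈ LinearMap.range (TensorProduct.map D.subtype D.subtype)

/-- A simple subcoalgebra: a nonzero one without proper nonzero subcoalgebra. -/
def IsSimpleSubcoalgebra {k : Type u} {C : Type v} [Field k] [AddCommGroup C] [Module k C]
    [Coalgebra k C] (D : Submodule k C) : Prop :=
  IsSubcoalgebra D ∧ D ≠ ⊥ ∧ ∀ D' ≤ D, IsSubcoalgebra D' → D' = ⊥ ∨ D' = D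

/-- A coalgebra is cosemisimple if it is the sum of its simple subcoalgebras. -/
def IsCosemisimple (k : Type u) (C : Type v) [Field k] [AddCommGroup C] [Module k C]
    [Coalgebra k C] : Prop :=
  sSup {D : Submodule k C | IsSimpleSubcoalgebra D} = ⊤

/-- A matrix `x` over a coalgebra is a (matrix) corepresentation, that is, the coefficient matrix
of a finite-dimensional comodule. -/
def IsCorepresentation (k : Type u) {C : Type v} [Field k] [AddCommGroup C] [Module k C]
    [Coalgebra k C] {m : ℕ} (x : Matrix (Fin m) (Fin m) C) : Prop :=
  (∀ i j, comul (R := k) (x i j) = ∑ l, x i l ⊗ₜ[k] x l j) ∧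
    ∀ i j, counit (R := k) (x i j) = if i = j then 1 else 0

/-- A complex Hopf algebra admits a CQG algebra structure: there is a `*`-algebra structure
(an antilinear antimultiplicative involution) for which `Δ` is a `*`-homomorphism and every
finite-dimensional comodule is unitarizable, i.e. for every corepresentation `x` there is
`F ∈ GL_m(ℂ)` such that `F x F⁻¹` is unitary. -/
def AdmitsCQGStructure (A : Type v) [Ring A] [HopfAlgebra ℂ A] : Prop :=
  ∃ (_ : StarRing A) (_ : StarModule ℂ A),
    (∀ x : A, comul (R := ℂ) (star x) = star (comul (R := ℂ) x)) ∧
    ∀ (m : ℕ) (x : Matrix (Fin m) (Fin m) A), IsCorepresentation ℂ x →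
      ∃ F : GL (Fin m) ℂ,
        (F : Matrix (Fin m) (Fin m) ℂ).map (algebraMap ℂ A) * x *
          ((F⁻¹ : GL (Fin m) ℂ) : Matrix (Fin m) (Fin m) ℂ).map (algebraMap ℂ A)
            ∈ unitary (Matrix (Fin m) (Fin m) A)

/-- A field can be ordered: it has a linear order making it an ordered field. -/
def IsOrderable (F : Type u) [Field F] : Prop :=
  ∃ _ : LinearOrder F, IsStrictOrderedRing F

end Hopf

end Cosovereign

/-! Everything rests on the matrix a of generators and the tensor powers of matrices (`wordMatrix`),
in which the relations say that E is fixed by a^{⊗N} on the column side and on the row side.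

Antipode. Splitting off the last factor of the column relation and contracting with a left dual of E
gives a left inverse of a; splitting off the first factor of the row relation gives a right inverse
(`leftInv_mul`, `mul_rightInv`). The inverse satisfies the same relations in the opposite algebra,
hence defines an anti-endomorphism S. The transpose of a satisfies the relations too, and its
inverse yields S⁻¹.

Sovereignty. Rotating an index N times brings it back, so E is fixed by diag(β), which gives the
character. The cyclicity also turns a left dual of E into a right dual, so the inverse of the
transpose of a is a rescaling of S(a) (`transpose_mul_rescale`); the rescaling is conjugation by the
character.

Cosemisimplicity. Subcoalgebras are the submodules for an algebra of endomorphisms, so it suffices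
to find complements inside spans of coefficients. They exist as soon as the form (f, g) ↦ tr(f(x)
g(x)) on the dual algebra is non-degenerate (`IsCorep.exists_complement`). For the tensor powers x
of k ⊕ V this holds by positivity: a_{ij} ↦ a_{ji} is an algebra automorphism over the ordered field
generated by the coefficients of E, so f can be paired with its transpose, giving a sum of squares
(`isTraceNondegenerate_words`).

CQG structure. For real E the antilinear version of this automorphism, followed by S, is the
involution, and it makes a unitary. It also makes the dual algebra of each tensor power closed under
conjugate transposition. Summing x(f) x(f)* over a Hilbert–Schmidt orthonormal basis of that algebra
produces a positive definite matrix that intertwines the two adjoints on a given corepresentation;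
its factorization G G* supplies the change of basis (`IsCorep.exists_unitarizing`). -/

namespace Cosovereign

universe u v

/-! ### Tensor powers of a matrix -/

section Words

variable {ι : Type*} {B : Type*}

/-- The `N`-th tensor power of a square matrix `b` over a ring: its entries are the products
`b_{i₁ j₁} ⋯ b_{i_N j_N}`. -/
def wordMatrix [Monoid B] (b : Matrix ι ι B) (N : ℕ) : Matrix (Fin N → ι) (Fin N → ι) B :=
  fun i j => (List.ofFn fun t => b (i t) (j t)).prod

theorem wordMatrix_apply [Monoid B] (b : Matrix ι ι B) {N : ℕ} (i j : Fin N → ι) :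
    wordMatrix b N i j = (List.ofFn fun t => b (i t) (j t)).prod := rfl

theorem wordMatrix_cons [Monoid B] (b : Matrix ι ι B) {N : ℕ} (p q : ι) (i j : Fin N → ι) :
    wordMatrix b (N + 1) (Fin.cons p i) (Fin.cons q j) = b p q * wordMatrix b N i j := by
  simp [wordMatrix, List.ofFn_succ]

theorem wordMatrix_snoc [Monoid B] (b : Matrix ι ι B) {N : ℕ} (p q : ι) (i j : Fin N → ι) :
    wordMatrix b (N + 1) (Fin.snoc i p : Fin (N + 1) → ι) (Fin.snoc j q : Fin (N + 1) → ι)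
      = wordMatrix b N i j * b p q := by
  rw [wordMatrix_apply, List.ofFn_succ']
  simp [wordMatrix_apply, List.concat_eq_append]

theorem sum_fin_cons [Fintype ι] {C : Type*} [AddCommMonoid C] {N : ℕ}
    (f : (Fin (N + 1) → ι) → C) :
    ∑ i, f i = ∑ p : ι, ∑ i : Fin N → ι, f (Fin.cons p i) := by
  rw [← Fintype.sum_prod_type']
  exact (Equiv.sum_comp (Fin.consEquiv fun _ : Fin (N + 1) => ι) f).symm

theorem sum_fin_snoc [Fintype ι] {C : Type*} [AddCommMonoid C] {N : ℕ}
    (f : (Fin (N + 1) → ι) → C) :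
    ∑ i, f i = ∑ p : ι, ∑ i : Fin N → ι, f (Fin.snoc i p) := by
  rw [← Fintype.sum_prod_type']
  exact (Equiv.sum_comp (Fin.snocEquiv fun _ : Fin (N + 1) => ι) f).symm

variable [Ring B]

theorem one_cons [DecidableEq ι] {N : ℕ} (p q : ι) (i j : Fin N → ι) :
    (1 : Matrix (Fin (N + 1) → ι) (Fin (N + 1) → ι) B) (Fin.cons p i) (Fin.cons q j)
      = (1 : Matrix ι ι B) p q * (1 : Matrix (Fin N → ι) (Fin N → ι) B) i j := by
  by_cases h : p = q <;> by_cases h' : i = j <;>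
    simp [Matrix.one_apply, h, h', Fin.cons_inj]

/-- The tensor power of `c`, with the products taken in the opposite order. -/
def wordMatrixOp (c : Matrix ι ι B) (N : ℕ) : Matrix (Fin N → ι) (Fin N → ι) B :=
  (wordMatrix (c.map MulOpposite.op) N).map MulOpposite.unop

theorem wordMatrixOp_cons (c : Matrix ι ι B) {N : ℕ} (p q : ι) (i j : Fin N → ι) :
    wordMatrixOp c (N + 1) (Fin.cons p i) (Fin.cons q j) = wordMatrixOp c N i j * c p q := by
  simp [wordMatrixOp, wordMatrix_cons]

variable [Fintype ι] [DecidableEq ι]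

/-- Entries need not commute, but with the second product reversed the innermost factors meet first,
so the sum collapses from the inside out. -/
theorem wordMatrix_mul_wordMatrixOp {b c : Matrix ι ι B} (h : b * c = 1) (N : ℕ) :
    wordMatrix b N * wordMatrixOp c N = 1 := by
  induction N with
  | zero =>
    ext i j
    obtain rfl := Subsingleton.elim i j
    simp [Matrix.mul_apply, wordMatrix, wordMatrixOp]
  | succ N ih =>
    ext i j
    obtain ⟨p, i, rfl⟩ : ∃ p i', i = Fin.cons p i' := ⟨_, _, (Fin.cons_self_tail i).symm⟩
    obtain ⟨q, j, rfl⟩ : ∃ p i', j = Fin.cons p i' := ⟨_, _, (Fin.cons_self_tail j).symm⟩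
    have hpq := congr_fun₂ h p q
    have hij := congr_fun₂ ih i j
    rw [Matrix.mul_apply] at hpq hij
    rw [Matrix.mul_apply, sum_fin_cons, one_cons]
    simp only [wordMatrix_cons, wordMatrixOp_cons]
    have (r : ι) : ∑ l : Fin N → ι,
        b p r * wordMatrix b N i l * (wordMatrixOp c N l j * c r q)
          = b p r * (1 : Matrix (Fin N → ι) (Fin N → ι) B) i j * c r q := by
      rw [← hij, Finset.mul_sum, Finset.sum_mul]
      exact Finset.sum_congr rfl fun _ _ => by simp only [mul_assoc]
    rw [Finset.sum_congr rfl fun r _ => this r]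
    by_cases hij' : i = j
    · subst hij'
      simp [← hpq]
    · simp [hij']

theorem wordMatrixOp_mul_wordMatrix {b c : Matrix ι ι B} (h : c * b = 1) (N : ℕ) :
    wordMatrixOp c N * wordMatrix b N = 1 := by
  induction N with
  | zero =>
    ext i j
    obtain rfl := Subsingleton.elim i j
    simp [Matrix.mul_apply, wordMatrix, wordMatrixOp]
  | succ N ih =>
    ext i j
    obtain ⟨p, i, rfl⟩ : ∃ p i', i = Fin.cons p i' := ⟨_, _, (Fin.cons_self_tail i).symm⟩
    obtain ⟨q, j, rfl⟩ : ∃ p i', j = Fin.cons p i' := ⟨_, _, (Fin.cons_self_tail j).symm⟩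
    have hpq := congr_fun₂ h p q
    have hij := congr_fun₂ ih i j
    rw [Matrix.mul_apply] at hpq hij
    rw [Matrix.mul_apply, sum_fin_cons, one_cons, Finset.sum_comm]
    simp only [wordMatrix_cons, wordMatrixOp_cons]
    have (l : Fin N → ι) : ∑ r : ι,
        wordMatrixOp c N i l * c p r * (b r q * wordMatrix b N l j)
          = wordMatrixOp c N i l * (1 : Matrix ι ι B) p q * wordMatrix b N l j := by
      rw [← hpq, Finset.mul_sum, Finset.sum_mul]
      exact Finset.sum_congr rfl fun _ _ => by simp only [mul_assoc]
    rw [Finset.sum_congr rfl fun l _ => this l]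
    by_cases hpq' : p = q
    · subst hpq'
      simp [← hij]
    · simp [hpq']

end Words

/-! ### Forms with invariant matrices -/

section Invariance

variable {k : Type u} [Field k] {n M N : ℕ} {B : Type v} [Ring B] [Algebra k B]

/-- The pure tensors of basis vectors span. The coordinates are chosen before φ, so they serve all
linear maps into W at once. -/
theorem Form.exists_sum_coeff {N : ℕ} {W : Type*} [AddCommGroup W] [Module k W]
    (x : ⨂[k] _ : Fin N, (Fin n → k)) :
    ∃ c : (Fin N → Fin n) → k, ∀ φ : (⨂[k] _ : Fin N, (Fin n → k)) →ₗ[k] W,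
      φ x = ∑ i, c i • φ (PiTensorProduct.tprod k fun t => Pi.single (i t) 1) := by
  induction x using PiTensorProduct.induction_on with
  | smul_tprod r f =>
    refine ⟨fun i => r * ∏ t, f t (i t), fun φ => ?_⟩
    have hf : f = fun t => ∑ l, f t l • (Pi.single l 1 : Fin n → k) := by
      funext t
      exact pi_eq_sum_univ' (f t)
    have := (PiTensorProduct.tprod k : MultilinearMap k (fun _ : Fin N => Fin n → k) _).map_sum
      (α := fun _ => Fin n) (fun t l => f t l • (Pi.single l 1 : Fin n → k))
    rw [← hf] at this
    rw [this]
    simp [MultilinearMap.map_smul_univ, Finset.smul_sum, mul_smul]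
  | add x y hx hy =>
    obtain ⟨c, hc⟩ := hx
    obtain ⟨d, hd⟩ := hy
    exact ⟨c + d, fun φ => by simp [hc, hd, add_smul, Finset.sum_add_distrib]⟩

/-- F l consists of the coordinates of a preimage, under `leftMap`, of the l-th coordinate form;
non-degeneracy is used only in this shape. -/
theorem Form.LeftNondegenerate.exists_dual {E : Form k n (M + 1)} (h : E.LeftNondegenerate) :
    ∃ F : Fin n → (Fin M → Fin n) → k, ∀ l m,
      ∑ i, F l i * E.coeff (Fin.snoc i m) = (1 : Matrix (Fin n) (Fin n) k) l m := by
  have h' (l : Fin n) : ∃ c : (Fin M → Fin n) → k, ∀ m,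
      ∑ i, c i * E.coeff (Fin.snoc i m) = (1 : Matrix (Fin n) (Fin n) k) l m := by
    obtain ⟨x, hx⟩ := h (LinearMap.proj l)
    obtain ⟨c, hc⟩ := Form.exists_sum_coeff (W := Module.Dual k (Fin n → k)) x
    refine ⟨c, fun m => ?_⟩
    have := congr($hx (Pi.single m 1))
    rw [hc] at this
    simp only [LinearMap.sum_apply, LinearMap.smul_apply, smul_eq_mul, LinearMap.proj_apply] at this
    rw [show (1 : Matrix (Fin n) (Fin n) k) l m = (Pi.single m 1 : Fin n → k) l by
      simp [Matrix.one_apply, Pi.single_apply], ← this]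
    refine Finset.sum_congr rfl fun i _ => ?_
    congr 1
    simp only [Form.leftMap, Form.coeff, PiTensorProduct.lift.tprod,
      MultilinearMap.curryRight_apply, LinearMap.compMultilinearMap_apply]
    congr 2
    funext t
    refine Fin.lastCases ?_ (fun t => ?_) t <;> simp
  choose F hF using h'
  exact ⟨F, hF⟩

theorem Form.RightNondegenerate.exists_dual {E : Form k n (M + 1)} (h : E.RightNondegenerate) :
    ∃ F : Fin n → (Fin M → Fin n) → k, ∀ m l,
      ∑ i, F l i * E.coeff (Fin.cons m i) = (1 : Matrix (Fin n) (Fin n) k) m l := by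
  have h' (l : Fin n) : ∃ c : (Fin M → Fin n) → k, ∀ m,
      ∑ i, c i * E.coeff (Fin.cons m i) = (1 : Matrix (Fin n) (Fin n) k) m l := by
    obtain ⟨x, hx⟩ := h (LinearMap.proj l)
    obtain ⟨c, hc⟩ := Form.exists_sum_coeff (W := Module.Dual k (Fin n → k)) x
    refine ⟨c, fun m => ?_⟩
    have := congr($hx (Pi.single m 1))
    rw [hc] at this
    simp only [LinearMap.sum_apply, LinearMap.smul_apply, smul_eq_mul, LinearMap.proj_apply] at this
    rw [show (1 : Matrix (Fin n) (Fin n) k) m l = (Pi.single m 1 : Fin n → k) l by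
      simp [Matrix.one_apply, Pi.single_apply, eq_comm], ← this]
    refine Finset.sum_congr rfl fun i _ => ?_
    congr 1
    simp only [Form.rightMap, Form.coeff, LinearMap.flip_apply, LinearMap.comp_apply,
      LinearEquiv.coe_coe, PiTensorProduct.lift.tprod,
      MultilinearMap.curryLeft_apply, LinearMap.compMultilinearMap_apply]
    congr 2
    funext t
    refine Fin.cases ?_ (fun t => ?_) t <;> simp
  choose F hF using h'
  exact ⟨F, fun m l => hF l m⟩

/-- `E` is invariant under the columns of `b`: `∑_j E(j) b_{j₁ i₁} ⋯ b_{j_N i_N} = E(i)`. -/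
def ColInvariant (E : Form k n N) (b : Matrix (Fin n) (Fin n) B) : Prop :=
  ∀ i, ∑ j, E.coeff j • wordMatrix b N j i = E.coeff i • 1

/-- `E` is invariant under the rows of `b`: `∑_j E(j) b_{i₁ j₁} ⋯ b_{i_N j_N} = E(i)`. -/
def RowInvariant (E : Form k n N) (b : Matrix (Fin n) (Fin n) B) : Prop :=
  ∀ i, ∑ j, E.coeff j • wordMatrix b N i j = E.coeff i • 1

theorem ColInvariant.transpose {E : Form k n N} {b : Matrix (Fin n) (Fin n) B}
    (h : ColInvariant E b) : RowInvariant E b.transpose := h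

theorem RowInvariant.transpose {E : Form k n N} {b : Matrix (Fin n) (Fin n) B}
    (h : RowInvariant E b) : ColInvariant E b.transpose := h

/-- The left inverse of a column invariant matrix given by a left dual of `E`. -/
noncomputable def leftInv (E : Form k n (M + 1)) (F : Fin n → (Fin M → Fin n) → k)
    (b : Matrix (Fin n) (Fin n) B) : Matrix (Fin n) (Fin n) B :=
  fun l j => ∑ i, F l i • ∑ j', E.coeff (Fin.snoc j' j) • wordMatrix b M j' i

/-- Multiplying by b on the right completes a word of length M to one of length M + 1, to which
column invariance applies; what remains is F contracted with E. -/
theorem leftInv_mul {E : Form k n (M + 1)} {F : Fin n → (Fin M → Fin n) → k}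
    (hF : ∀ l m, ∑ i, F l i * E.coeff (Fin.snoc i m) = (1 : Matrix (Fin n) (Fin n) k) l m)
    {b : Matrix (Fin n) (Fin n) B} (hb : ColInvariant E b) : leftInv E F b * b = 1 := by
  ext l m
  have h1 : (1 : Matrix (Fin n) (Fin n) B) l m = (1 : Matrix (Fin n) (Fin n) k) l m • (1 : B) := by
    by_cases h : l = m <;> simp [Matrix.one_apply, h]
  rw [h1, ← hF, Finset.sum_smul, Matrix.mul_apply]
  simp only [leftInv, Finset.sum_mul, smul_mul_assoc, ← wordMatrix_snoc]
  rw [Finset.sum_comm]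
  refine Finset.sum_congr rfl fun i _ => ?_
  rw [← Finset.smul_sum, mul_smul, ← hb, sum_fin_snoc]

/-- The right inverse of a row invariant matrix given by a right dual of `E`. -/
noncomputable def rightInv (E : Form k n (M + 1)) (F : Fin n → (Fin M → Fin n) → k)
    (b : Matrix (Fin n) (Fin n) B) : Matrix (Fin n) (Fin n) B :=
  fun j l => ∑ i, F l i • ∑ j', E.coeff (Fin.cons j j') • wordMatrix b M i j'

theorem mul_rightInv {E : Form k n (M + 1)} {F : Fin n → (Fin M → Fin n) → k}
    (hF : ∀ m l, ∑ i, F l i * E.coeff (Fin.cons m i) = (1 : Matrix (Fin n) (Fin n) k) m l)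
    {b : Matrix (Fin n) (Fin n) B} (hb : RowInvariant E b) : b * rightInv E F b = 1 := by
  ext m l
  have h1 : (1 : Matrix (Fin n) (Fin n) B) m l = (1 : Matrix (Fin n) (Fin n) k) m l • (1 : B) := by
    by_cases h : m = l <;> simp [Matrix.one_apply, h]
  rw [h1, ← hF, Finset.sum_smul, Matrix.mul_apply]
  simp only [rightInv, Finset.mul_sum, mul_smul_comm, ← wordMatrix_cons]
  rw [Finset.sum_comm]
  refine Finset.sum_congr rfl fun i _ => ?_
  rw [← Finset.smul_sum, mul_smul, ← hb, sum_fin_cons]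

/-- Replace each coefficient of E by its invariance relation and cancel the tensor power of b
against the reversed one of c. This is what lets an inverse of the generators define a morphism to
the opposite algebra. -/
theorem ColInvariant.op {E : Form k n N} {b c : Matrix (Fin n) (Fin n) B}
    (hb : ColInvariant E b) (h : b * c = 1) : ColInvariant E (c.map MulOpposite.op) := by
  intro i
  apply MulOpposite.unop_injective
  have hw := wordMatrix_mul_wordMatrixOp h N
  calc _ = ∑ j, E.coeff j • wordMatrixOp c N j i := by
        simp [wordMatrixOp]
    _ = ∑ j, (E.coeff j • (1 : B)) * wordMatrixOp c N j i := by simp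
    _ = ∑ j, ∑ l, E.coeff l • (wordMatrix b N l j * wordMatrixOp c N j i) := by
        simp only [← hb _, Finset.sum_mul, smul_mul_assoc]
    _ = ∑ l, E.coeff l • (wordMatrix b N * wordMatrixOp c N) l i := by
        rw [Finset.sum_comm]
        simp only [Matrix.mul_apply, Finset.smul_sum]
    _ = _ := by simp [hw, Matrix.one_apply]

theorem RowInvariant.op {E : Form k n N} {b c : Matrix (Fin n) (Fin n) B}
    (hb : RowInvariant E b) (h : c * b = 1) : RowInvariant E (c.map MulOpposite.op) := by
  intro i
  apply MulOpposite.unop_injective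
  have hw := wordMatrixOp_mul_wordMatrix h N
  calc _ = ∑ j, E.coeff j • wordMatrixOp c N i j := by
        simp [wordMatrixOp]
    _ = ∑ j, wordMatrixOp c N i j * (E.coeff j • (1 : B)) := by simp
    _ = ∑ j, ∑ l, E.coeff l • (wordMatrixOp c N i j * wordMatrix b N j l) := by
        simp only [← hb _, Finset.mul_sum, mul_smul_comm]
    _ = ∑ l, E.coeff l • (wordMatrixOp c N * wordMatrix b N) i l := by
        rw [Finset.sum_comm]
        simp only [Matrix.mul_apply, Finset.smul_sum]
    _ = _ := by simp [hw, Matrix.one_apply]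

end Invariance

/-! ### The antipode of `SL(E)` -/

section AntipodeCriterion

variable {k : Type u} {A : Type v} [Field k] [Ring A] [Bialgebra k A]

/-- The linear map underlying an anti-endomorphism. -/
def unopLinear (S : A →ₐ[k] Aᵐᵒᵖ) : A →ₗ[k] A :=
  (MulOpposite.opLinearEquiv k).symm.toLinearMap ∘ₗ S.toLinearMap

@[simp]
theorem unopLinear_apply (S : A →ₐ[k] Aᵐᵒᵖ) (x : A) : unopLinear S x = (S x).unop := rfl

/-- By antimultiplicativity, the contraction of t (p ⊗ q) is S(p) · (contraction of t) · q, and a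
scalar in the middle can be pulled out. So the antipode identity passes to products. -/
theorem mul'_rTensor_mul (S : A →ₐ[k] Aᵐᵒᵖ) {t : A ⊗[k] A} {c : k}
    (ht : LinearMap.mul' k A ((unopLinear S).rTensor A t) = algebraMap k A c) (s : A ⊗[k] A) :
    LinearMap.mul' k A ((unopLinear S).rTensor A (t * s))
      = algebraMap k A c * LinearMap.mul' k A ((unopLinear S).rTensor A s) := by
  induction s with
  | zero => simp
  | add x y hx hy => simp only [mul_add, map_add, hx, hy]
  | tmul p q =>
    have h : LinearMap.mul' k A ((unopLinear S).rTensor A (t * p ⊗ₜ q))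
        = (S p).unop * LinearMap.mul' k A ((unopLinear S).rTensor A t) * q := by
      clear ht
      induction t with
      | zero => simp
      | add x y hx hy => simp only [mul_add, add_mul, map_add, hx, hy]
      | tmul x y => simp [mul_assoc]
    rw [h, ht, ← Algebra.commutes]
    simp [mul_assoc]

theorem mul'_lTensor_mul (S : A →ₐ[k] Aᵐᵒᵖ) {s : A ⊗[k] A} {c : k}
    (hs : LinearMap.mul' k A ((unopLinear S).lTensor A s) = algebraMap k A c) (t : A ⊗[k] A) :
    LinearMap.mul' k A ((unopLinear S).lTensor A (t * s))
      = LinearMap.mul' k A ((unopLinear S).lTensor A t) * algebraMap k A c := by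
  induction t with
  | zero => simp
  | add x y hx hy => simp only [add_mul, map_add, hx, hy]
  | tmul p q =>
    have h : LinearMap.mul' k A ((unopLinear S).lTensor A (p ⊗ₜ q * s))
        = p * LinearMap.mul' k A ((unopLinear S).lTensor A s) * (S q).unop := by
      clear hs
      induction s with
      | zero => simp
      | add x y hx hy => simp only [mul_add, add_mul, map_add, hx, hy]
      | tmul x y => simp [mul_assoc]
    rw [h, hs, ← Algebra.commutes]
    simp [mul_assoc, Algebra.commutes]

/-- It is enough to check that an anti-endomorphism is an antipode on algebra generators. -/
theorem isAntipode_of_adjoin (S : A →ₐ[k] Aᵐᵒᵖ) {s : Set A} (hs : Algebra.adjoin k s = ⊤)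
    (hl : ∀ x ∈ s, LinearMap.mul' k A ((unopLinear S).rTensor A (comul x))
      = algebraMap k A (counit x))
    (hr : ∀ x ∈ s, LinearMap.mul' k A ((unopLinear S).lTensor A (comul x))
      = algebraMap k A (counit x)) :
    IsAntipode k (unopLinear S) where
  left := by
    ext x
    have hx : x ∈ Algebra.adjoin k s := hs ▸ Algebra.mem_top
    simp only [LinearMap.comp_apply, Algebra.linearMap_apply]
    induction hx using Algebra.adjoin_induction with
    | mem x hx => exact hl x hx
    | algebraMap r => simp [Bialgebra.comul_algebraMap, Algebra.TensorProduct.algebraMap_apply]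
    | add x y _ _ hx hy => simp only [map_add, hx, hy]
    | mul x y _ _ hx hy =>
      rw [Bialgebra.comul_mul, mul'_rTensor_mul S hx, hy, Bialgebra.counit_mul, map_mul]
  right := by
    ext x
    have hx : x ∈ Algebra.adjoin k s := hs ▸ Algebra.mem_top
    simp only [LinearMap.comp_apply, Algebra.linearMap_apply]
    induction hx using Algebra.adjoin_induction with
    | mem x hx => exact hr x hx
    | algebraMap r => simp [Bialgebra.comul_algebraMap, Algebra.TensorProduct.algebraMap_apply]
    | add x y _ _ hx hy => simp only [map_add, hx, hy]
    | mul x y _ _ hx hy =>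
      rw [Bialgebra.comul_mul, mul'_lTensor_mul S hy, hx, Bialgebra.counit_mul, map_mul]

end AntipodeCriterion

/-! ### Inverting the generators and constructing the antipode of `SL(E)` -/

namespace SL

variable {k : Type u} [Field k] {n M N : ℕ}

/-- The matrix of generators of `SL(E)`. -/
noncomputable def gen (E : Form k n N) : Matrix (Fin n) (Fin n) (SL E) := Matrix.of (a E)

@[simp]
theorem gen_apply (E : Form k n N) (i j : Fin n) : gen E i j = a E i j := rfl

theorem colInvariant_gen (E : Form k n N) : ColInvariant E (gen E) := col_rel E

theorem rowInvariant_gen (E : Form k n N) : RowInvariant E (gen E) := row_rel E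

theorem adjoin_gen (E : Form k n N) :
    Algebra.adjoin k (Set.range fun p : Fin n × Fin n => a E p.1 p.2) = ⊤ := by
  rw [eq_top_iff]
  rintro x -
  obtain ⟨y, rfl⟩ := RingQuot.mkAlgHom_surjective k (SL.Rel E) x
  induction y using FreeAlgebra.induction with
  | grade0 r =>
    rw [AlgHom.commutes]
    exact Subalgebra.algebraMap_mem _ r
  | grade1 p => exact Algebra.subset_adjoin ⟨p, rfl⟩
  | mul x y hx hy =>
    rw [map_mul]
    exact mul_mem hx hy
  | add x y hx hy =>
    rw [map_add]
    exact add_mem hx hy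

theorem induction {E : Form k n N} {P : SL E → Prop} (algebraMap : ∀ r, P (algebraMap k (SL E) r))
    (gen : ∀ i j, P (a E i j)) (add : ∀ x y, P x → P y → P (x + y))
    (mul : ∀ x y, P x → P y → P (x * y)) (x : SL E) : P x := by
  have hx : x ∈ Algebra.adjoin k (Set.range fun p : Fin n × Fin n => a E p.1 p.2) :=
    adjoin_gen E ▸ Algebra.mem_top
  induction hx using Algebra.adjoin_induction with
  | mem x hx =>
    obtain ⟨p, rfl⟩ := hx
    exact gen p.1 p.2
  | algebraMap r => exact algebraMap r
  | add x y _ _ hx hy => exact add x y hx hy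
  | mul x y _ _ hx hy => exact mul x y hx hy

theorem exists_gen_inv {E : Form k n (M + 1)} (hl : E.LeftNondegenerate)
    (hr : E.RightNondegenerate) {B : Type v} [Ring B] [Algebra k B]
    {b : Matrix (Fin n) (Fin n) B} (hcol : ColInvariant E b) (hrow : RowInvariant E b) :
    ∃ c : Matrix (Fin n) (Fin n) B, b * c = 1 ∧ c * b = 1 := by
  obtain ⟨F, hF⟩ := hl.exists_dual
  obtain ⟨G, hG⟩ := hr.exists_dual
  have h1 := leftInv_mul hF hcol
  have h2 := mul_rightInv hG hrow
  exact ⟨_, h2, by rwa [← left_inv_eq_right_inv h1 h2]⟩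

/-- The algebra morphism to an algebra given by invariant matrices. -/
noncomputable def ofInvariant {E : Form k n N} {B : Type v} [Ring B] [Algebra k B]
    {b : Matrix (Fin n) (Fin n) B} (hcol : ColInvariant E b) (hrow : RowInvariant E b) :
    SL E →ₐ[k] B :=
  lift b hcol hrow

@[simp]
theorem ofInvariant_a {E : Form k n N} {B : Type v} [Ring B] [Algebra k B]
    {b : Matrix (Fin n) (Fin n) B} (hcol : ColInvariant E b) (hrow : RowInvariant E b)
    (i j : Fin n) : ofInvariant hcol hrow (a E i j) = b i j := lift_a _ _ _ _ _

theorem exists_antipode {E : Form k n (M + 1)} (hl : E.LeftNondegenerate)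
    (hr : E.RightNondegenerate) :
    ∃ S : SL E →ₗ[k] SL E, IsAntipode k S ∧ Function.Bijective S := by
  have hcol := colInvariant_gen E
  have hrow := rowInvariant_gen E
  obtain ⟨b, hab, hba⟩ := exists_gen_inv hl hr hcol hrow
  -- Transposition exchanges the two families of relations, so the transpose of the generators is
  -- invertible too. Its inverse c is in general not the transpose of b; it provides the inverse T
  -- of S.
  obtain ⟨c, hac, hca⟩ := exists_gen_inv hl hr hrow.transpose hcol.transpose
  let S : SL E →ₐ[k] (SL E)ᵐᵒᵖ := ofInvariant (hcol.op hab) (hrow.op hba)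
  let T : SL E →ₐ[k] (SL E)ᵐᵒᵖ :=
    ofInvariant (hcol.transpose.op hca).transpose (hrow.transpose.op hac).transpose
  have hS (i j) : (S (a E i j)).unop = b i j := by simp [S]
  have hT (i j) : (T (a E i j)).unop = c j i := by simp [T]
  have hone (i j : Fin n) : algebraMap k (SL E) (if i = j then 1 else 0)
      = (1 : Matrix (Fin n) (Fin n) (SL E)) i j := by
    by_cases h : i = j <;> simp [h, Matrix.one_apply]
  -- Applying S to the identity aᵗ c = 1 exhibits the transpose of S(c) as a left inverse of b,
  -- hence as a.
  have hST (x : SL E) : (S (T x).unop).unop = x := by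
    have hSc (i j) : (S (c j i)).unop = a E i j := by
      have h : (Matrix.of fun i j => (S (c j i)).unop) * b = 1 := by
        ext i j
        have := congr_arg (fun x => (S x).unop) (congr_fun₂ hac j i)
        simp only [Matrix.mul_apply, map_sum, map_mul, Matrix.transpose_apply, gen_apply,
          MulOpposite.unop_mul, hS, Finset.unop_sum] at this
        rw [Matrix.mul_apply]
        refine this.trans ?_
        by_cases h : i = j <;> simp [h, Matrix.one_apply, eq_comm]
      have h' := left_inv_eq_right_inv h hba
      exact congr_fun₂ h' i j
    induction x using SL.induction with
    | algebraMap r => simp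
    | gen i j => rw [hT, hSc]
    | add x y hx hy => simp [hx, hy]
    | mul x y hx hy => simp [hx, hy]
  have hTS (x : SL E) : (T (S x).unop).unop = x := by
    have hTb (i j) : (T (b i j)).unop = a E i j := by
      have h : (Matrix.of fun i j => (T (b j i)).unop) * c = 1 := by
        ext i j
        have := congr_arg (fun x => (T x).unop) (congr_fun₂ hab j i)
        simp only [Matrix.mul_apply, map_sum, map_mul, gen_apply,
          MulOpposite.unop_mul, hT, Finset.unop_sum] at this
        rw [Matrix.mul_apply]
        refine this.trans ?_
        by_cases h : i = j <;> simp [h, Matrix.one_apply, eq_comm]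
      have h' := left_inv_eq_right_inv h hca
      exact congr_fun₂ h' j i
    induction x using SL.induction with
    | algebraMap r => simp
    | gen i j => rw [hS, hTb]
    | add x y hx hy => simp [hx, hy]
    | mul x y hx hy => simp [hx, hy]
  refine ⟨unopLinear S, isAntipode_of_adjoin S (adjoin_gen E) ?_ ?_,
    Function.bijective_iff_has_inverse.mpr ⟨unopLinear T, hTS, hST⟩⟩
  · rintro _ ⟨⟨i, j⟩, rfl⟩
    rw [comul_a, counit_a, hone, ← hba, Matrix.mul_apply]
    simp [hS]
  · rintro _ ⟨⟨i, j⟩, rfl⟩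
    rw [comul_a, counit_a, hone, ← hab, Matrix.mul_apply]
    simp [hS]

end SL

/-! ### Sovereign characters -/

/-! ### Convolution of anti-endomorphisms with characters -/

section Convolution

variable {k : Type u} {A : Type v} [Field k] [Ring A]

theorem commute_ofId_comp [Algebra k A] {B : Type*} [Ring B] [Algebra k B] (Φ : A →ₐ[k] k) (x : A)
    (y : B) : Commute (((Algebra.ofId k B).comp Φ) x) y :=
  Algebra.commutes (Φ x) y

/-- The convolution product of a character and an anti-endomorphism. -/
noncomputable def charConv [Bialgebra k A] (Φ : A →ₐ[k] k) (L : A →ₐ[k] Aᵐᵒᵖ) : A →ₐ[k] Aᵐᵒᵖ :=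
  (Algebra.TensorProduct.lift ((Algebra.ofId k Aᵐᵒᵖ).comp Φ) L
    fun x y => commute_ofId_comp Φ x (L y)).comp (Bialgebra.comulAlgHom k A)

/-- The convolution product of an anti-endomorphism and a character. -/
noncomputable def convChar [Bialgebra k A] (L : A →ₐ[k] Aᵐᵒᵖ) (Φ : A →ₐ[k] k) : A →ₐ[k] Aᵐᵒᵖ :=
  (Algebra.TensorProduct.lift L ((Algebra.ofId k Aᵐᵒᵖ).comp Φ)
    fun x y => (commute_ofId_comp Φ y (L x)).symm).comp (Bialgebra.comulAlgHom k A)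

theorem toConv_charConv [Bialgebra k A] (Φ : A →ₐ[k] k) (L : A →ₐ[k] Aᵐᵒᵖ) :
    WithConv.toConv (unopLinear (charConv Φ L)) =
      WithConv.toConv (Algebra.linearMap k A ∘ₗ Φ.toLinearMap) *
        WithConv.toConv (unopLinear L) := by
  ext x
  rw [LinearMap.convMul_apply]
  simp only [unopLinear_apply, charConv, AlgHom.comp_apply,
    Bialgebra.comulAlgHom_apply]
  generalize (comul x : A ⊗[k] A) = t
  induction t with
  | zero => simp
  | add x y hx hy => simp only [map_add, MulOpposite.unop_add, hx, hy]
  | tmul x y =>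
    simp [Algebra.ofId_apply, MulOpposite.algebraMap_apply, Algebra.commutes]

theorem toConv_convChar [Bialgebra k A] (L : A →ₐ[k] Aᵐᵒᵖ) (Φ : A →ₐ[k] k) :
    WithConv.toConv (unopLinear (convChar L Φ)) =
      WithConv.toConv (unopLinear L) *
        WithConv.toConv (Algebra.linearMap k A ∘ₗ Φ.toLinearMap) := by
  ext x
  rw [LinearMap.convMul_apply]
  simp only [unopLinear_apply, convChar, AlgHom.comp_apply,
    Bialgebra.comulAlgHom_apply]
  generalize (comul x : A ⊗[k] A) = t
  induction t with
  | zero => simp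
  | add x y hx hy => simp only [map_add, MulOpposite.unop_add, hx, hy]
  | tmul x y =>
    simp [Algebra.ofId_apply, MulOpposite.algebraMap_apply, Algebra.commutes]

theorem charConv_apply [Bialgebra k A] (Φ : A →ₐ[k] k) (L : A →ₐ[k] Aᵐᵒᵖ) {ι : Type*} [Fintype ι]
    {x : A} {y z : ι → A} (hx : comul (R := k) x = ∑ l, y l ⊗ₜ[k] z l) :
    (charConv Φ L x).unop = ∑ l, Φ (y l) • (L (z l)).unop := by
  simp [charConv, hx, Algebra.ofId_apply, Algebra.smul_def, Algebra.commutes]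

theorem convChar_apply [Bialgebra k A] (L : A →ₐ[k] Aᵐᵒᵖ) (Φ : A →ₐ[k] k) {ι : Type*} [Fintype ι]
    {x : A} {y z : ι → A} (hx : comul (R := k) x = ∑ l, y l ⊗ₜ[k] z l) :
    (convChar L Φ x).unop = ∑ l, Φ (z l) • (L (y l)).unop := by
  simp [convChar, hx, Algebra.ofId_apply, ← Algebra.smul_def]

variable [HopfAlgebra k A]

/-- The convolution inverse of a character of a Hopf algebra. -/
noncomputable def charInv (Φ : A →ₐ[k] k) : A →ₐ[k] k :=
  AlgHom.ofLinearMap (Φ.toLinearMap ∘ₗ antipode k) (by simp)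
    fun x y => by simp [antipode_mul_antidistrib, mul_comm]

@[simp]
theorem charInv_apply (Φ : A →ₐ[k] k) (x : A) : charInv Φ x = Φ (antipode k x) := rfl

theorem toConv_mul_charInv (Φ : A →ₐ[k] k) :
    WithConv.toConv Φ.toLinearMap * WithConv.toConv (charInv Φ).toLinearMap = 1 := by
  have h := LinearMap.algHom_comp_convMul_distrib Φ (WithConv.toConv (LinearMap.id : A →ₗ[k] A))
    (WithConv.toConv (antipode k))
  rw [LinearMap.id_mul_antipode] at h
  refine (congr_arg WithConv.toConv h).symm.trans ?_
  ext x
  simp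

theorem toConv_charInv_mul (Φ : A →ₐ[k] k) :
    WithConv.toConv (charInv Φ).toLinearMap * WithConv.toConv Φ.toLinearMap = 1 := by
  have h := LinearMap.algHom_comp_convMul_distrib Φ (WithConv.toConv (antipode k))
    (WithConv.toConv (LinearMap.id : A →ₗ[k] A))
  rw [LinearMap.antipode_mul_id] at h
  refine (congr_arg WithConv.toConv h).symm.trans ?_
  ext x
  simp

end Convolution

/-! ### Cyclic forms and the diagonal character -/

section Sovereign

variable {k : Type u} [Field k] {n M : ℕ}

/-- Each rotation of the multi-index costs one factor β, and M + 1 rotations restore it after every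
position has contributed once. -/
theorem Form.prod_mul_coeff {E : Form k n (M + 1)} {β : Fin n → k}
    (hβ : ∀ (i : Fin n) (j : Fin M → Fin n),
      E.coeff (Fin.snoc j i) = β i * E.coeff (Fin.cons i j)) (i : Fin (M + 1) → Fin n) :
    (∏ t, β (i t)) * E.coeff i = E.coeff i := by
  -- The multi-index is extended periodically to ℕ, so that rotating becomes shifting.
  let w (t : ℕ) : Fin n := i (Fin.ofNat (M + 1) t)
  have hstep (r : ℕ) : E.coeff (fun t : Fin (M + 1) => w (t + (r + 1)))
      = β (w r) * E.coeff (fun t : Fin (M + 1) => w (t + r)) := by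
    have h := hβ (w r) (fun t => w (t + (r + 1)))
    convert h using 2
    · funext t
      refine Fin.lastCases ?_ (fun t => ?_) t
      · simp only [Fin.val_last, Fin.snoc_last, w]
        congr 1
        ext
        simp [show M + (r + 1) = r + (M + 1) by ring]
      · simp
    · congr 1
      funext t
      refine Fin.cases ?_ (fun t => ?_) t
      · simp
      · simp only [Fin.val_succ, Fin.cons_succ]
        congr 1
        ring
  have hprod (r : ℕ) : E.coeff (fun t : Fin (M + 1) => w (t + r))
      = (∏ s ∈ Finset.range r, β (w s)) * E.coeff i := by
    induction r with
    | zero => simp [w]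
    | succ r ih => rw [hstep, ih, Finset.prod_range_succ]; ring
  have h := hprod (M + 1)
  rw [Finset.prod_range] at h
  have h1 : (fun t : Fin (M + 1) => w (t + (M + 1))) = i := by
    funext t
    simp only [w]
    congr 1
    ext
    simp [Nat.mod_eq_of_lt t.isLt]
  rw [h1] at h
  simpa [w] using h.symm

theorem SL.wordMatrix_diagonal (β : Fin n → k) {N : ℕ} (i j : Fin N → Fin n) :
    wordMatrix (Matrix.diagonal β) N i j = if i = j then ∏ t, β (i t) else 0 := by
  rw [wordMatrix_apply, List.prod_ofFn]
  simp only [Matrix.diagonal_apply]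
  rw [Finset.prod_ite_zero]
  simp [funext_iff]

theorem colInvariant_diagonal {E : Form k n (M + 1)} {β : Fin n → k}
    (hβ : ∀ (i : Fin n) (j : Fin M → Fin n),
      E.coeff (Fin.snoc j i) = β i * E.coeff (Fin.cons i j)) :
    ColInvariant E (Matrix.diagonal β) := fun i => by
  simp [SL.wordMatrix_diagonal, mul_comm _ (∏ t, β _), Form.prod_mul_coeff hβ]

/-- The character `a_{ij} ↦ δ_{ij} β_i` of `SL(E)`. -/
noncomputable def SL.diagChar {E : Form k n (M + 1)} {β : Fin n → k}
    (hβ : ∀ (i : Fin n) (j : Fin M → Fin n),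
      E.coeff (Fin.snoc j i) = β i * E.coeff (Fin.cons i j)) : SL E →ₐ[k] k :=
  ofInvariant (colInvariant_diagonal hβ)
    (Matrix.diagonal_transpose β ▸ (colInvariant_diagonal hβ).transpose)

theorem SL.diagChar_a {E : Form k n (M + 1)} {β : Fin n → k}
    (hβ : ∀ (i : Fin n) (j : Fin M → Fin n),
      E.coeff (Fin.snoc j i) = β i * E.coeff (Fin.cons i j)) (i j : Fin n) :
    diagChar hβ (a E i j) = if i = j then β i else 0 := by
  rw [diagChar, ofInvariant_a, Matrix.diagonal_apply]

/-- Under a cyclicity condition on `E`, the inverse of the transpose of an invariant matrix is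
obtained from the inverse of the matrix by rescaling. -/
theorem transpose_mul_rescale {E : Form k n (M + 1)} (hl : E.LeftNondegenerate) {β : Fin n → kˣ}
    (hβ : ∀ (i : Fin n) (j : Fin M → Fin n),
      E.coeff (Fin.snoc j i) = β i * E.coeff (Fin.cons i j))
    {B : Type v} [Ring B] [Algebra k B] {b c : Matrix (Fin n) (Fin n) B}
    (hb : ColInvariant E b) (hbc : b * c = 1) :
    b.transpose * (Matrix.of fun l j => ((β j : k) * (β l : k)⁻¹) • c j l) = 1 := by
  obtain ⟨F, hF⟩ := hl.exists_dual
  -- Cyclicity turns the left dual F, with row l scaled by β l, into a right dual.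
  have hG (m l) : ∑ i, (β l * F l i) * E.coeff (Fin.cons m i)
      = (1 : Matrix (Fin n) (Fin n) k) m l := by
    have h := hF l m
    simp only [hβ] at h
    have h2 : ∑ i, (β l * F l i) * E.coeff (Fin.cons m i)
        = (β l * (β m : k)⁻¹) * ∑ i, F l i * (β m * E.coeff (Fin.cons m i)) := by
      rw [Finset.mul_sum]
      refine Finset.sum_congr rfl fun i _ => ?_
      have : (β m : k) ≠ 0 := (β m).ne_zero
      field_simp
    rw [h2, h]
    by_cases hml : m = l
    · subst hml
      simp
    · simp [hml, Ne.symm hml]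
  -- By uniqueness of inverses c is the explicit left inverse, which can be compared term by term
  -- with the right inverse of the transpose built from the rescaled dual.
  have hc : c = leftInv E F b := (left_inv_eq_right_inv (leftInv_mul hF hb) hbc).symm
  rw [← mul_rightInv hG hb.transpose]
  congr 1
  ext j l
  simp only [Matrix.of_apply, hc, leftInv, rightInv, Finset.smul_sum, smul_smul, hβ]
  refine Finset.sum_congr rfl fun i _ => Finset.sum_congr rfl fun j' _ => ?_
  have hne : (β j : k) ≠ 0 := (β j).ne_zero
  rw [show wordMatrix b.transpose M i j' = wordMatrix b M j' i from rfl]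
  congr 1
  field_simp

end Sovereign

/-! ### Corepresentations and the antipode -/

section Corep

variable {k : Type u} [Field k] {ι : Type*} [Fintype ι] [DecidableEq ι]

/-- A matrix over a coalgebra, indexed by a finite type, which is the coefficient matrix of a
comodule. -/
structure IsCorep (k : Type u) [Field k] {C : Type v} [AddCommGroup C] [Module k C]
    [Coalgebra k C] (x : Matrix ι ι C) : Prop where
  comul_apply : ∀ i j, comul (R := k) (x i j) = ∑ l, x i l ⊗ₜ[k] x l j
  counit_apply : ∀ i j, counit (R := k) (x i j) = if i = j then 1 else 0

variable {A : Type v} [Ring A] [HopfAlgebra k A] {x : Matrix ι ι A}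

theorem IsCorep.mul_antipode (hx : IsCorep k x) : x * x.map (antipode k) = 1 := by
  ext i j
  have h := mul_antipode_lTensor_comul_apply (R := k) (x i j)
  rw [hx.comul_apply, hx.counit_apply] at h
  simp only [map_sum, LinearMap.lTensor_tmul, LinearMap.mul'_apply] at h
  rw [Matrix.mul_apply]
  refine h.trans ?_
  by_cases hij : i = j <;> simp [hij, Matrix.one_apply]

theorem IsCorep.antipode_mul (hx : IsCorep k x) : x.map (antipode k) * x = 1 := by
  ext i j
  have h := mul_antipode_rTensor_comul_apply (R := k) (x i j)
  rw [hx.comul_apply, hx.counit_apply] at h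
  simp only [map_sum, LinearMap.rTensor_tmul, LinearMap.mul'_apply] at h
  rw [Matrix.mul_apply]
  refine h.trans ?_
  by_cases hij : i = j <;> simp [hij, Matrix.one_apply]

end Corep

namespace SL

variable {k : Type u} [Field k] {n M N : ℕ}

theorem isCorep_gen (E : Form k n N) : IsCorep k (gen E) := ⟨comul_a E, counit_a E⟩

theorem isSovereignCharacter_diagChar {E : Form k n (M + 1)} (hl : E.LeftNondegenerate)
    {S : SL E →ₗ[k] SL E} (hS : IsAntipode k S) (hbij : Function.Bijective S) {β : Fin n → kˣ}
    (hβ : ∀ (i : Fin n) (j : Fin M → Fin n),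
      E.coeff (Fin.snoc j i) = β i * E.coeff (Fin.cons i j)) :
    letI : HopfAlgebra k (SL E) := hS.hopfAlgebra
    IsSovereignCharacter (diagChar (β := fun i => (β i : k)) hβ) := by
  let : HopfAlgebra k (SL E) := hS.hopfAlgebra
  set Φ := diagChar (β := fun i => (β i : k)) hβ
  -- U is Φ * S * Φ⁻¹. Scalars being central, it is an anti-endomorphism, so it can be compared with
  -- S⁻¹ on generators.
  let U := convChar (charConv Φ (antipodeAlgHomOp k (SL E))) (charInv Φ)
  have hgen : IsCorep k (gen E) := isCorep_gen E
  have hab := hgen.mul_antipode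
  have hba := hgen.antipode_mul
  have hΦa (i j) : Φ (a E i j) = if i = j then (β i : k) else 0 := diagChar_a _ i j
  -- Obtained by applying Φ to the identity a S(a) = 1.
  have hΨa (i j) : charInv Φ (a E i j) = if i = j then (β i : k)⁻¹ else 0 := by
    have h1 : (Matrix.diagonal fun i => (β i : k)) * (gen E).map (charInv Φ) = 1 := by
      ext i j
      have := congr_arg Φ (congr_fun₂ hab i j)
      simp only [Matrix.mul_apply, map_sum, map_mul, gen_apply, hΦa, Matrix.map_apply] at this
      simp only [Matrix.diagonal_mul, Matrix.map_apply, gen_apply, charInv_apply]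
      rw [show (1 : Matrix (Fin n) (Fin n) k) i j
        = Φ ((1 : Matrix (Fin n) (Fin n) (SL E)) i j) by
          by_cases h : i = j <;> simp [h, Matrix.one_apply], ← this]
      simp
    have h2 := congr_fun₂ h1 i j
    simp only [Matrix.diagonal_mul, Matrix.map_apply, gen_apply] at h2
    have hne : (β i : k) ≠ 0 := (β i).ne_zero
    rw [← mul_right_inj' hne, h2]
    by_cases h : i = j <;> simp [h, Matrix.one_apply]
  have hU (i j) : (U (a E i j)).unop = ((β i : k) * (β j : k)⁻¹) • antipode k (a E i j) := by
    simp [U, convChar_apply _ _ (comul_a E i _), charConv_apply _ _ (comul_a E i _), hΦa, hΨa,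
      smul_smul, mul_comm]
  -- The rescaled inverse of the transpose has the values of U as entries; applying S to that
  -- identity shows that S(U(a)) is a left inverse of S(a), hence equals a.
  have hSU (x) : antipode k (U x).unop = x := by
    have h1 : (Matrix.of fun i j => antipode k (U (a E i j)).unop) * (gen E).map (antipode k)
        = 1 := by
      ext i j
      have h2 := transpose_mul_rescale hl hβ (colInvariant_gen E) hab
      have := congr_arg (antipode k) (congr_fun₂ h2 j i)
      simp only [Matrix.mul_apply, map_sum, antipode_mul_antidistrib, Matrix.transpose_apply,
        Matrix.of_apply, Matrix.map_apply, gen_apply, ← hU] at this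
      rw [Matrix.mul_apply]
      refine this.trans ?_
      by_cases h : i = j <;> simp [h, Matrix.one_apply, eq_comm]
    have h3 := left_inv_eq_right_inv h1 hba
    induction x using SL.induction with
    | algebraMap r =>
      have h (r : k) : antipode k (algebraMap k (SL E) r) = algebraMap k (SL E) r := by
        rw [Algebra.algebraMap_eq_smul_one, map_smul, antipode_one]
      simp [MulOpposite.algebraMap_apply, h]
    | gen i j => exact congr_fun₂ h3 i j
    | add x y hx hy => simp only [map_add, MulOpposite.unop_add, hx, hy]
    | mul x y hx hy =>
      simp only [map_mul, MulOpposite.unop_mul, antipode_mul_antidistrib, hx, hy]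
  refine ⟨(charInv Φ).toLinearMap, unopLinear U,
    ⟨toConv_mul_charInv Φ, toConv_charInv_mul Φ⟩, ⟨?_, LinearMap.ext hSU⟩, ?_⟩
  · ext x
    exact hbij.1 (hSU (S x))
  · rw [toConv_convChar, toConv_charConv]
    rfl

end SL

/-! ### Subcoalgebras and semisimplicity -/

section Actions

variable {k : Type u} {C : Type v} [Field k] [AddCommGroup C] [Module k C] [Coalgebra k C]

/-- The endomorphism `x ↦ ∑ f(x₁) x₂` of a coalgebra. -/
noncomputable def actL (f : Module.Dual k C) : Module.End k C :=
  (TensorProduct.lid k C).toLinearMap ∘ₗ f.rTensor C ∘ₗ comul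

/-- The endomorphism `x ↦ ∑ f(x₂) x₁` of a coalgebra. -/
noncomputable def actR (f : Module.Dual k C) : Module.End k C :=
  (TensorProduct.rid k C).toLinearMap ∘ₗ f.lTensor C ∘ₗ comul

/-- The convolution product of two linear forms on a coalgebra. -/
noncomputable def conv (f g : Module.Dual k C) : Module.Dual k C :=
  LinearMap.mul' k k ∘ₗ TensorProduct.map f g ∘ₗ comul

theorem conv_eq_actL (f g : Module.Dual k C) (x : C) : conv f g x = g (actL f x) := by
  simp only [conv, actL, LinearMap.comp_apply]
  generalize (comul x : C ⊗[k] C) = t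
  induction t with
  | zero => simp
  | add x y hx hy => simp only [map_add, hx, hy]
  | tmul x y => simp

theorem conv_eq_actR (f g : Module.Dual k C) (x : C) : conv f g x = f (actR g x) := by
  simp only [conv, actR, LinearMap.comp_apply]
  generalize (comul x : C ⊗[k] C) = t
  induction t with
  | zero => simp
  | add x y hx hy => simp only [map_add, hx, hy]
  | tmul x y => simp [mul_comm]

/-- A subspace stable under all the endomorphisms `actL f` and `actR f`. -/
def IsStable (D : Submodule k C) : Prop :=
  ∀ f : Module.Dual k C, ∀ x ∈ D, actL f x ∈ D ∧ actR f x ∈ D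

theorem eq_of_forall_rTensor {V W : Type*} [AddCommGroup V] [Module k V] [AddCommGroup W]
    [Module k W] {s t : V ⊗[k] W} (h : ∀ f : Module.Dual k V, f.rTensor W s = f.rTensor W t) :
    s = t := by
  classical
  let b := Module.Basis.ofVectorSpace k V
  apply (TensorProduct.equivFinsuppOfBasisLeft (N := W) b).injective
  ext i
  have key (r : V ⊗[k] W) : TensorProduct.equivFinsuppOfBasisLeft b r i
      = TensorProduct.lid k W ((b.coord i).rTensor W r) := by
    induction r with
    | zero => simp
    | add x y hx hy => simp only [map_add, Finsupp.add_apply, hx, hy]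
    | tmul x y => simp
  rw [key, key, h]

theorem eq_of_forall_lTensor {V W : Type*} [AddCommGroup V] [Module k V] [AddCommGroup W]
    [Module k W] {s t : V ⊗[k] W} (h : ∀ f : Module.Dual k W, f.lTensor V s = f.lTensor V t) :
    s = t := by
  apply (TensorProduct.comm k V W).injective
  refine eq_of_forall_rTensor fun f => ?_
  have key (r : V ⊗[k] W) : f.rTensor V (TensorProduct.comm k V W r)
      = TensorProduct.comm k V k (f.lTensor V r) := by
    induction r with
    | zero => simp
    | add x y hx hy => simp only [map_add, hx, hy]
    | tmul x y => simp
  rw [key, key, h]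

/-- For the converse, project onto D: stability says that every slice of Δ(x) along one leg lies in
D, and slices separate tensors, so the projection applied to either leg fixes Δ(x). -/
theorem isSubcoalgebra_iff_isStable {D : Submodule k C} : IsSubcoalgebra D ↔ IsStable D := by
  constructor
  · intro h f x hx
    obtain ⟨t, ht⟩ := h x hx
    simp only [actL, actR, LinearMap.comp_apply, ← ht]
    clear ht
    induction t with
    | zero => simp
    | add x y hx hy =>
      simp only [map_add]
      exact ⟨add_mem hx.1 hy.1, add_mem hx.2 hy.2⟩
    | tmul x y => simp [D.smul_mem]
  · intro h x hx
    obtain ⟨D', hD⟩ := D.exists_isCompl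
    let p : C →ₗ[k] D := D.projectionOnto D' hD
    have hp (y : C) (hy : y ∈ D) : D.subtype (p y) = y := by
      exact congr_arg Subtype.val (Submodule.projectionOnto_apply_left hD ⟨y, hy⟩)
    let q : C →ₗ[k] C := D.subtype ∘ₗ p
    have h1 : q.lTensor C (comul x) = comul x := by
      refine eq_of_forall_rTensor fun f => ?_
      apply (TensorProduct.lid k C).injective
      have := hp _ (h f x hx).1
      rw [← LinearMap.comp_apply, LinearMap.rTensor_comp_lTensor,
        ← LinearMap.lTensor_comp_rTensor, LinearMap.comp_apply]
      refine Eq.trans ?_ this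
      simp only [actL, LinearMap.comp_apply]
      generalize (f.rTensor C) (comul x) = t
      induction t with
      | zero => simp
      | add x y hx hy => simp only [map_add, hx, hy]
      | tmul x y => simp [q]
    have h2 : q.rTensor C (comul x) = comul x := by
      refine eq_of_forall_lTensor fun f => ?_
      apply (TensorProduct.rid k C).injective
      have := hp _ (h f x hx).2
      rw [← LinearMap.comp_apply, LinearMap.lTensor_comp_rTensor,
        ← LinearMap.rTensor_comp_lTensor, LinearMap.comp_apply]
      refine Eq.trans ?_ this
      simp only [actR, LinearMap.comp_apply]
      generalize (f.lTensor C) (comul x) = t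
      induction t with
      | zero => simp
      | add x y hx hy => simp only [map_add, hx, hy]
      | tmul x y => simp [q]
    refine ⟨TensorProduct.map p p (comul x), ?_⟩
    rw [← LinearMap.comp_apply, ← TensorProduct.map_comp, ← LinearMap.rTensor_comp_lTensor,
      LinearMap.comp_apply]
    exact (congr_arg _ h1).trans h2

variable (k C) in
/-- The algebra of endomorphisms generated by the `actL f` and the `actR f`: its invariant
subspaces are the subcoalgebras. -/
noncomputable abbrev actAlgebra : Subalgebra k (Module.End k C) :=
  Algebra.adjoin k (Set.range actL ∪ Set.range actR)

/-- A stable subspace as a submodule over `actAlgebra`. -/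
noncomputable def IsStable.toSubmodule {D : Submodule k C} (h : IsStable D) :
    Submodule (actAlgebra k C) C where
  carrier := D
  add_mem' := D.add_mem
  zero_mem' := D.zero_mem
  smul_mem' := by
    rintro ⟨r, hr⟩ x hx
    change r x ∈ D
    induction hr using Algebra.adjoin_induction generalizing x with
    | mem r hr =>
      rcases hr with ⟨f, rfl⟩ | ⟨f, rfl⟩
      · exact (h f x hx).1
      · exact (h f x hx).2
    | algebraMap r => exact D.smul_mem r hx
    | add r s _ _ hr hs => exact D.add_mem (hr hx) (hs hx)
    | mul r s _ _ hr hs => exact hr (hs hx)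

@[simp]
theorem IsStable.mem_toSubmodule {D : Submodule k C} (h : IsStable D) {x : C} :
    x ∈ h.toSubmodule ↔ x ∈ D := Iff.rfl

theorem isStable_restrictScalars (P : Submodule (actAlgebra k C) C) :
    IsStable (P.restrictScalars k) := fun f _ hx =>
  ⟨P.smul_mem ⟨actL f, Algebra.subset_adjoin (Or.inl ⟨f, rfl⟩)⟩ hx,
    P.smul_mem ⟨actR f, Algebra.subset_adjoin (Or.inr ⟨f, rfl⟩)⟩ hx⟩

/-- Submodules over `actAlgebra` are exactly the subcoalgebras, so simple submodules are simple
subcoalgebras and the general theory of semisimple modules applies. -/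
theorem isCosemisimple_of_isSemisimpleModule [IsSemisimpleModule (actAlgebra k C) C] :
    IsCosemisimple k C := by
  have h := IsSemisimpleModule.sSup_simples_eq_top (actAlgebra k C) C
  have h' := congr_arg (Submodule.restrictScalars k) h
  rw [Submodule.restrictScalars_sSup, Submodule.restrictScalars_top] at h'
  rw [IsCosemisimple, eq_top_iff, ← h']
  refine sSup_le_sSup ?_
  rintro _ ⟨P, hP, rfl⟩
  have hP' := isSimpleModule_iff_isAtom.mp hP
  refine ⟨isSubcoalgebra_iff_isStable.mpr (isStable_restrictScalars P), ?_, fun D hD hDs => ?_⟩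
  · intro hbot
    exact hP'.1 ((Submodule.restrictScalars_eq_bot_iff k _ _).mp hbot)
  · have hst := isSubcoalgebra_iff_isStable.mp hDs
    have hle : hst.toSubmodule ≤ P := fun x hx => hD hx
    rcases hP'.le_iff.mp hle with h0 | h0
    · left
      ext x
      rw [← hst.mem_toSubmodule, h0]
      simp
    · right
      ext x
      rw [← hst.mem_toSubmodule, h0]
      simp

/-- A coalgebra spanned by stable subspaces whose stable subspaces have stable complements is
cosemisimple. -/
theorem isCosemisimple_of_complements {ι : Type*} {D : ι → Submodule k C}
    (hD : ∀ i, IsStable (D i)) (htop : ⨆ i, D i = ⊤)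
    (hcompl : ∀ i, ∀ P ≤ D i, IsStable P → ∃ Q ≤ D i, IsStable Q ∧ P ⊓ Q = ⊥ ∧ P ⊔ Q = D i) :
    IsCosemisimple k C := by
  have : IsSemisimpleModule (actAlgebra k C) C := by
    refine isSemisimpleModule_of_isSemisimpleModule_submodule'
      (p := fun i => (hD i).toSubmodule) (fun i => ?_) ?_
    · rw [isSemisimpleModule_iff, (Submodule.mapIic _).complementedLattice_iff,
        Set.Iic.complementedLattice_iff]
      intro P hP
      obtain ⟨Q, hQ, hQs, hinf, hsup⟩ := hcompl i (P.restrictScalars k) (fun x hx => hP hx)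
        (isStable_restrictScalars P)
      refine ⟨hQs.toSubmodule, hQ, ?_, ?_⟩
      · ext x
        have := congr(x ∈ $hinf)
        simpa using this
      · apply Submodule.restrictScalars_injective k (actAlgebra k C) C
        rw [Submodule.restrictScalars_sup]
        exact hsup
    · apply Submodule.restrictScalars_injective k (actAlgebra k C) C
      rw [Submodule.restrictScalars_iSup]
      exact htop
  exact isCosemisimple_of_isSemisimpleModule

end Actions

/-! ### The trace form and complements of subcoalgebras -/

section TraceForm

variable {k : Type u} {C : Type v} [Field k] [AddCommGroup C] [Module k C] {ι : Type*}
  {x : Matrix ι ι C}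

variable (k x) in
/-- The span of the coefficients of a matrix. -/
def coeffSpan : Submodule k C := Submodule.span k (Set.range fun p : ι × ι => x p.1 p.2)

theorem mem_coeffSpan (i j : ι) : x i j ∈ coeffSpan k x := Submodule.subset_span ⟨(i, j), rfl⟩

variable [Fintype ι]

variable (k x) in
/-- The map `f ↦ ∑ f(x_{ij}) x_{ji}` from linear forms to coefficients. -/
noncomputable def traceMap : Module.Dual k C →ₗ[k] C :=
  ∑ i, ∑ j, (Module.Dual.eval k C (x i j)).smulRight (x j i)

theorem traceMap_apply (f : Module.Dual k C) :
    traceMap k x f = ∑ i, ∑ j, f (x i j) • x j i := by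
  simp [traceMap]

theorem apply_traceMap (f g : Module.Dual k C) :
    g (traceMap k x f) = ∑ i, ∑ j, f (x i j) * g (x j i) := by
  simp [traceMap_apply]

theorem apply_traceMap_comm (f g : Module.Dual k C) :
    g (traceMap k x f) = f (traceMap k x g) := by
  rw [apply_traceMap, apply_traceMap, Finset.sum_comm]
  simp only [mul_comm]

theorem traceMap_mem_coeffSpan (f : Module.Dual k C) : traceMap k x f ∈ coeffSpan k x := by
  rw [traceMap_apply]
  exact sum_mem fun i _ => sum_mem fun j _ => Submodule.smul_mem _ _ (mem_coeffSpan _ _)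

/-- A corepresentation whose trace form is non-degenerate on the algebra of linear forms. -/
def IsTraceNondegenerate (k : Type u) {C : Type v} [Field k] [AddCommGroup C] [Module k C]
    (x : Matrix ι ι C) : Prop :=
  ∀ f : Module.Dual k C, (∀ g : Module.Dual k C, ∑ i, ∑ j, f (x i j) * g (x j i) = 0) →
    ∀ i j, f (x i j) = 0

variable [Coalgebra k C] [DecidableEq ι]

theorem IsCorep.actL_apply (hx : IsCorep k x) (f : Module.Dual k C) (i j : ι) :
    actL f (x i j) = ∑ l, f (x i l) • x l j := by
  simp [actL, hx.comul_apply]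

theorem IsCorep.actR_apply (hx : IsCorep k x) (f : Module.Dual k C) (i j : ι) :
    actR f (x i j) = ∑ l, f (x l j) • x i l := by
  simp [actR, hx.comul_apply]

theorem IsCorep.conv_apply (hx : IsCorep k x) (f g : Module.Dual k C) (i j : ι) :
    conv f g (x i j) = ∑ l, f (x i l) * g (x l j) := by
  simp [conv, hx.comul_apply]

theorem IsCorep.isStable_coeffSpan (hx : IsCorep k x) : IsStable (coeffSpan k x) := by
  intro f y hy
  induction hy using Submodule.span_induction with
  | mem y hy =>
    obtain ⟨⟨i, j⟩, rfl⟩ := hy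
    rw [hx.actL_apply, hx.actR_apply]
    exact ⟨sum_mem fun l _ => Submodule.smul_mem _ _ (mem_coeffSpan _ _),
      sum_mem fun l _ => Submodule.smul_mem _ _ (mem_coeffSpan _ _)⟩
  | zero => simp
  | add y z _ _ hy hz =>
    simp only [map_add]
    exact ⟨add_mem hy.1 hz.1, add_mem hy.2 hz.2⟩
  | smul r y _ hy =>
    simp only [map_smul]
    exact ⟨Submodule.smul_mem _ _ hy.1, Submodule.smul_mem _ _ hy.2⟩

theorem IsCorep.actL_traceMap (hx : IsCorep k x) (f g : Module.Dual k C) :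
    actL g (traceMap k x f) = traceMap k x (conv f g) := by
  simp only [traceMap_apply, map_sum, map_smul, hx.actL_apply, hx.conv_apply, Finset.smul_sum,
    Finset.sum_smul, smul_smul]
  refine Finset.sum_congr rfl fun i _ => ?_
  rw [Finset.sum_comm]

theorem IsCorep.actR_traceMap (hx : IsCorep k x) (f g : Module.Dual k C) :
    actR f (traceMap k x g) = traceMap k x (conv f g) := by
  simp only [traceMap_apply, map_sum, map_smul, hx.actR_apply, hx.conv_apply, Finset.smul_sum,
    Finset.sum_smul, smul_smul]
  rw [Finset.sum_comm]
  conv_rhs => rw [Finset.sum_comm]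
  refine Finset.sum_congr rfl fun j _ => ?_
  rw [Finset.sum_comm]
  simp only [mul_comm]

/-- For every g, the form h = f * g inherits both hypotheses on f. Then h * h is orthogonal to
everything, so h acts as a matrix of square zero and has trace 0; thus f itself is orthogonal to
every g. -/
theorem IsCorep.apply_eq_zero (hx : IsCorep k x) (hnd : IsTraceNondegenerate k x)
    {D : Submodule k C} (hD : IsStable D) {f : Module.Dual k C} (hf : ∀ y ∈ D, f y = 0)
    (hfD : traceMap k x f ∈ D) (i j : ι) : f (x i j) = 0 := by
  refine hnd f (fun g => ?_) i j
  let h := conv f g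
  have hh : ∀ y ∈ D, h y = 0 := fun y hy => by
    rw [conv_eq_actR]
    exact hf _ (hD g y hy).2
  have hhD : traceMap k x h ∈ D := by
    rw [← hx.actL_traceMap]
    exact (hD g _ hfD).1
  -- The pairing of h * h with z is moved, by symmetry and equivariance of `traceMap`, to h
  -- evaluated on a translate of `traceMap h`, which stays in D.
  have hsq : ∀ i j, conv h h (x i j) = 0 := hnd _ fun z => by
    rw [← apply_traceMap, apply_traceMap_comm, conv_eq_actR, hx.actR_traceMap,
      ← hx.actL_traceMap]
    exact hh _ (hD z _ hhD).1
  have hnil : IsNilpotent (x.map h) := by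
    refine ⟨2, ?_⟩
    rw [pow_two]
    ext i j
    rw [Matrix.mul_apply]
    simpa [hx.conv_apply] using hsq i j
  have htr := (Matrix.isNilpotent_trace_of_isNilpotent hnil).eq_zero
  simpa [Matrix.trace, h, hx.conv_apply] using htr

/-- The annihilator of D is a two-sided ideal of the dual algebra; its image under `traceMap` is the
complement. -/
theorem IsCorep.exists_complement (hx : IsCorep k x) (hnd : IsTraceNondegenerate k x)
    {D : Submodule k C} (hDx : D ≤ coeffSpan k x) (hD : IsStable D) :
    ∃ D' ≤ coeffSpan k x, IsStable D' ∧ D ⊓ D' = ⊥ ∧ D ⊔ D' = coeffSpan k x := by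
  have hD'x : D.dualAnnihilator.map (traceMap k x) ≤ coeffSpan k x := by
    rintro _ ⟨f, -, rfl⟩
    exact traceMap_mem_coeffSpan f
  refine ⟨D.dualAnnihilator.map (traceMap k x), hD'x, ?_, ?_, ?_⟩
  · rintro g _ ⟨f, hf, rfl⟩
    rw [SetLike.mem_coe, Submodule.mem_dualAnnihilator] at hf
    rw [hx.actL_traceMap, hx.actR_traceMap]
    refine ⟨Submodule.mem_map_of_mem ((Submodule.mem_dualAnnihilator _).mpr fun y hy => ?_),
      Submodule.mem_map_of_mem ((Submodule.mem_dualAnnihilator _).mpr fun y hy => ?_)⟩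
    · rw [conv_eq_actR]
      exact hf _ (hD g y hy).2
    · rw [conv_eq_actL]
      exact hf _ (hD g y hy).1
  · rw [eq_bot_iff]
    rintro _ ⟨hy, f, hf, rfl⟩
    rw [SetLike.mem_coe, Submodule.mem_dualAnnihilator] at hf
    have := hx.apply_eq_zero hnd hD hf hy
    simp [traceMap_apply, this]
  · refine le_antisymm (sup_le hDx hD'x) (Submodule.span_le.mpr ?_)
    rintro _ ⟨⟨i, j⟩, rfl⟩
    -- Choose g vanishing on D and its proposed complement but not on x i j. If `traceMap g` were
    -- outside D, some f annihilating D would detect it, yet by symmetry that value is g on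
    -- `traceMap f`, hence 0.
    by_contra hij
    obtain ⟨g, hg, hker⟩ := Submodule.exists_le_ker_of_notMem hij
    have hgD : ∀ y ∈ D, g y = 0 := fun y hy => hker (Submodule.mem_sup_left hy)
    refine hg (hx.apply_eq_zero hnd hD hgD ?_ i j)
    by_contra hgD'
    obtain ⟨f, hf, hfker⟩ := Submodule.exists_le_ker_of_notMem hgD'
    apply hf
    rw [apply_traceMap_comm]
    exact hker (Submodule.mem_sup_right (Submodule.mem_map_of_mem
      ((Submodule.mem_dualAnnihilator _).mpr fun y hy => hfker hy)))

/-- A coalgebra spanned by coefficients of corepresentations with non-degenerate trace form is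
cosemisimple. -/
theorem isCosemisimple_of_isTraceNondegenerate {κ : Type*} {ι : κ → Type*} [∀ s, Fintype (ι s)]
    [∀ s, DecidableEq (ι s)] {x : ∀ s, Matrix (ι s) (ι s) C} (hx : ∀ s, IsCorep k (x s))
    (hnd : ∀ s, IsTraceNondegenerate k (x s)) (htop : ⨆ s, coeffSpan k (x s) = ⊤) :
    IsCosemisimple k C :=
  isCosemisimple_of_complements (fun s => (hx s).isStable_coeffSpan) htop
    fun s _ hP hPs => (hx s).exists_complement (hnd s) hP hPs

end TraceForm

/-! ### Cosemisimplicity of `SL(E)` -/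

section Words

variable {ι : Type*} {B : Type*}

theorem map_wordMatrix [Monoid B] {B' F : Type*} [Monoid B'] [FunLike F B B']
    [MonoidHomClass F B B'] (f : F) (b : Matrix ι ι B) {N : ℕ} (i j : Fin N → ι) :
    f (wordMatrix b N i j) = wordMatrix (b.map f) N i j := by
  simp [wordMatrix_apply, map_list_prod, List.map_ofFn, Function.comp_def]

theorem IsCorep.wordMatrix {k : Type u} [Field k] [Fintype ι] [DecidableEq ι] [Ring B]
    [Bialgebra k B] {x : Matrix ι ι B} (hx : IsCorep k x) (N : ℕ) :
    IsCorep k (wordMatrix x N) := by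
  induction N with
  | zero =>
    constructor <;> intro i j <;> obtain rfl := Subsingleton.elim i j
    · simp [wordMatrix_apply, Algebra.TensorProduct.one_def]
    · simp [wordMatrix_apply]
  | succ N ih =>
    constructor <;> intro i j
    all_goals
      obtain ⟨p, i, rfl⟩ : ∃ p i', i = Fin.cons p i' := ⟨_, _, (Fin.cons_self_tail i).symm⟩
      obtain ⟨q, j, rfl⟩ : ∃ p i', j = Fin.cons p i' := ⟨_, _, (Fin.cons_self_tail j).symm⟩
    · rw [wordMatrix_cons, Bialgebra.comul_mul, hx.comul_apply, ih.comul_apply, sum_fin_cons,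
        Finset.sum_mul_sum]
      simp only [wordMatrix_cons, Algebra.TensorProduct.tmul_mul_tmul]
    · rw [wordMatrix_cons, Bialgebra.counit_mul, hx.counit_apply, ih.counit_apply]
      by_cases h : p = q <;> by_cases h' : i = j <;> simp [h, h', Fin.cons_inj]

/-- The direct sum of a square matrix and the `1 × 1` identity matrix. -/
def augment [Zero B] [One B] (b : Matrix ι ι B) : Matrix (Option ι) (Option ι) B
  | none, none => 1
  | some i, some j => b i j
  | none, some _ => 0
  | some _, none => 0

@[simp]
theorem augment_none_none [Zero B] [One B] (b : Matrix ι ι B) : augment b none none = 1 := rfl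

@[simp]
theorem augment_some_some [Zero B] [One B] (b : Matrix ι ι B) (i j : ι) :
    augment b (some i) (some j) = b i j := rfl

@[simp]
theorem augment_none_some [Zero B] [One B] (b : Matrix ι ι B) (i : ι) :
    augment b none (some i) = 0 := rfl

@[simp]
theorem augment_some_none [Zero B] [One B] (b : Matrix ι ι B) (i : ι) :
    augment b (some i) none = 0 := rfl

theorem augment_map [Ring B] {B' F : Type*} [Ring B'] [FunLike F B B']
    [RingHomClass F B B'] (f : F) (b : Matrix ι ι B) :
    (augment b).map f = augment (b.map f) := by
  ext (_ | i) (_ | j) <;> simp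

theorem augment_transpose [Zero B] [One B] (b : Matrix ι ι B) :
    augment b.transpose = (augment b).transpose := by
  ext (_ | i) (_ | j) <;> rfl

theorem IsCorep.augment {k : Type u} [Field k] [Fintype ι] [DecidableEq ι] [Ring B]
    [Bialgebra k B] {x : Matrix ι ι B} (hx : IsCorep k x) : IsCorep k (augment x) where
  comul_apply := by
    rintro (_ | i) (_ | j) <;>
      simp [Fintype.sum_option, hx.comul_apply, Algebra.TensorProduct.one_def]
  counit_apply := by
    rintro (_ | i) (_ | j) <;> simp [hx.counit_apply]

end Words

/-! ### Tensor powers of k ⊕ V exhaust `SL(E)` -/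

namespace SL

variable {k : Type u} [Field k] {n N : ℕ}

/-- The corepresentation of `SL(E)` on `(k ⊕ V) ^ ⊗m`. -/
noncomputable def words (E : Form k n N) (m : ℕ) :
    Matrix (Fin m → Option (Fin n)) (Fin m → Option (Fin n)) (SL E) :=
  wordMatrix (augment (gen E)) m

theorem isCorep_words (E : Form k n N) (m : ℕ) : IsCorep k (words E m) :=
  (isCorep_gen E).augment.wordMatrix m

/-- The summand k in k ⊕ V pads a word by a factor 1. The spans are therefore nested, and finitely
many elements always lie in a single one. -/
theorem coeffSpan_words_mono (E : Form k n N) : Monotone fun m => coeffSpan k (words E m) := by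
  refine monotone_nat_of_le_succ fun m => Submodule.span_le.mpr ?_
  rintro _ ⟨⟨i, j⟩, rfl⟩
  have : words E m i j = words E (m + 1) (Fin.cons none i) (Fin.cons none j) := by
    simp [words, wordMatrix_cons]
  simp only [this]
  exact mem_coeffSpan _ _

theorem a_mul_mem_coeffSpan {E : Form k n N} {m : ℕ} {y : SL E}
    (hy : y ∈ coeffSpan k (words E m)) (p q : Fin n) :
    a E p q * y ∈ coeffSpan k (words E (m + 1)) := by
  induction hy using Submodule.span_induction with
  | mem y hy =>
    obtain ⟨⟨i, j⟩, rfl⟩ := hy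
    have : a E p q * words E m i j = words E (m + 1) (Fin.cons (some p) i)
        (Fin.cons (some q) j) := by
      simp [words, wordMatrix_cons]
    simp only [this]
    exact mem_coeffSpan _ _
  | zero => simp
  | add y z _ _ hy hz => rw [mul_add]; exact add_mem hy hz
  | smul r y _ hy => rw [mul_smul_comm]; exact Submodule.smul_mem _ _ hy

theorem exists_mem_coeffSpan_words {E : Form k n N} (x : SL E) :
    ∃ m, x ∈ coeffSpan k (words E m) := by
  -- Strengthened to left multiplication by x, so that the case of a product needs only prepending
  -- of single generators.
  have h : ∀ m, ∀ y ∈ coeffSpan k (words E m), ∃ m', x * y ∈ coeffSpan k (words E m') := by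
    induction x using SL.induction with
    | algebraMap r =>
      intro m y hy
      exact ⟨m, by rw [← Algebra.smul_def]; exact Submodule.smul_mem _ _ hy⟩
    | gen i j => exact fun m y hy => ⟨m + 1, a_mul_mem_coeffSpan hy i j⟩
    | add x z hx hz =>
      intro m y hy
      obtain ⟨m₁, h₁⟩ := hx m y hy
      obtain ⟨m₂, h₂⟩ := hz m y hy
      refine ⟨max m₁ m₂, ?_⟩
      rw [add_mul]
      exact add_mem (coeffSpan_words_mono E (le_max_left _ _) h₁)
        (coeffSpan_words_mono E (le_max_right _ _) h₂)
    | mul x z hx hz =>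
      intro m y hy
      obtain ⟨m₁, h₁⟩ := hz m y hy
      obtain ⟨m₂, h₂⟩ := hx m₁ _ h₁
      exact ⟨m₂, by rwa [mul_assoc]⟩
  have h1 : (1 : SL E) ∈ coeffSpan k (words E 0) := by
    have : words E 0 Fin.elim0 Fin.elim0 = 1 := by simp [words, wordMatrix_apply]
    rw [← this]
    exact mem_coeffSpan _ _
  simpa using h 0 1 h1

/-- The algebra automorphism `a_{ij} ↦ a_{ji}` of `SL(E)`. -/
noncomputable def transposeHom (E : Form k n N) : SL E →ₐ[k] SL E :=
  ofInvariant (rowInvariant_gen E).transpose (colInvariant_gen E).transpose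

theorem transposeHom_words (E : Form k n N) {m : ℕ} (i j : Fin m → Option (Fin n)) :
    transposeHom E (words E m i j) = words E m j i := by
  have : (gen E).map (transposeHom E) = (gen E).transpose := by
    ext i j
    simp [transposeHom]
  rw [words, map_wordMatrix, augment_map, this, augment_transpose]
  rfl

end SL

/-! ### Descent to an ordered subfield -/

section BaseChange

variable {k₀ k : Type*} [Field k₀] [Field k] [Algebra k₀ k] {n N : ℕ} {E₀ : Form k₀ n N}
  {E : Form k n N}

theorem ColInvariant.baseChange (hE : ∀ j, algebraMap k₀ k (E₀.coeff j) = E.coeff j)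
    {B₀ B : Type*} [Ring B₀] [Algebra k₀ B₀] [Ring B] [Algebra k B] [Algebra k₀ B]
    [IsScalarTower k₀ k B] {b : Matrix (Fin n) (Fin n) B₀} (hb : ColInvariant E₀ b)
    (f : B₀ →ₐ[k₀] B) : ColInvariant E (b.map f) := by
  intro i
  have := congr_arg f (hb i)
  simp only [map_sum, map_smul, map_wordMatrix, map_one] at this
  simpa only [← hE, algebraMap_smul] using this

theorem RowInvariant.baseChange (hE : ∀ j, algebraMap k₀ k (E₀.coeff j) = E.coeff j)
    {B₀ B : Type*} [Ring B₀] [Algebra k₀ B₀] [Ring B] [Algebra k B] [Algebra k₀ B]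
    [IsScalarTower k₀ k B] {b : Matrix (Fin n) (Fin n) B₀} (hb : RowInvariant E₀ b)
    (f : B₀ →ₐ[k₀] B) : RowInvariant E (b.map f) :=
  (hb.transpose.baseChange hE f).transpose

theorem ColInvariant.restrict (hE : ∀ j, algebraMap k₀ k (E₀.coeff j) = E.coeff j)
    {B : Type*} [Ring B] [Algebra k B] [Algebra k₀ B]
    [IsScalarTower k₀ k B] {b : Matrix (Fin n) (Fin n) B} (hb : ColInvariant E b) :
    ColInvariant E₀ b := by
  intro i
  simpa only [← hE, algebraMap_smul] using hb i

theorem RowInvariant.restrict (hE : ∀ j, algebraMap k₀ k (E₀.coeff j) = E.coeff j)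
    {B : Type*} [Ring B] [Algebra k B] [Algebra k₀ B]
    [IsScalarTower k₀ k B] {b : Matrix (Fin n) (Fin n) B} (hb : RowInvariant E b) :
    RowInvariant E₀ b :=
  (hb.transpose.restrict hE).transpose

namespace SL

/-- A linear form on `SL(E₀)` extends to a linear form on `SL(E)` with the same values on
words. -/
theorem exists_extend_dual (hE : ∀ j, algebraMap k₀ k (E₀.coeff j) = E.coeff j)
    (f : Module.Dual k₀ (SL E₀)) : ∃ g : Module.Dual k (SL E), ∀ m i j,
      g (words E m i j) = algebraMap k₀ k (f (words E₀ m i j)) := by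
  let inc : SL E₀ →ₐ[k₀] k ⊗[k₀] SL E₀ := Algebra.TensorProduct.includeRight
  let φ : SL E →ₐ[k] k ⊗[k₀] SL E₀ := ofInvariant
    ((colInvariant_gen E₀).baseChange hE inc) ((rowInvariant_gen E₀).baseChange hE inc)
  have hφ : (gen E).map φ = (gen E₀).map inc := by
    ext i j
    simp [φ]
  refine ⟨f.baseChange k ∘ₗ φ.toLinearMap, fun m i j => ?_⟩
  have : φ (words E m i j) = inc (words E₀ m i j) := by
    rw [words, words, map_wordMatrix, map_wordMatrix, augment_map, augment_map, hφ]
  simp [this, inc, Algebra.algebraMap_eq_smul_one]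

/-- A linear form on `SL(E)` can be restricted to `SL(E₀)` along a linear form on the field. -/
theorem exists_restrict_dual (hE : ∀ j, algebraMap k₀ k (E₀.coeff j) = E.coeff j)
    (f : Module.Dual k (SL E)) (l : Module.Dual k₀ k) : ∃ g : Module.Dual k₀ (SL E₀), ∀ m i j,
      g (words E₀ m i j) = l (f (words E m i j)) := by
  let : Algebra k₀ (SL E) := Algebra.compHom (SL E) (algebraMap k₀ k)
  have : IsScalarTower k₀ k (SL E) := IsScalarTower.of_algebraMap_eq fun _ => rfl
  let φ : SL E₀ →ₐ[k₀] SL E := ofInvariant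
    ((colInvariant_gen E).restrict hE) ((rowInvariant_gen E).restrict hE)
  have hφ : (gen E₀).map φ = gen E := by
    ext i j
    simp [φ]
  refine ⟨l ∘ₗ f.restrictScalars k₀ ∘ₗ φ.toLinearMap, fun m i j => ?_⟩
  have : φ (words E₀ m i j) = words E m i j := by
    rw [words, words, map_wordMatrix, augment_map, hφ]
  simp [this]

/-- Only k₀ is ordered, so values of f are first pushed to k₀ by an arbitrary k₀-linear form l on k.
Pairing f with the transpose of l ∘ f and applying l gives a sum of squares in k₀, whose terms must
vanish; as l varies, f vanishes. -/
theorem isTraceNondegenerate_words [LinearOrder k₀] [IsStrictOrderedRing k₀]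
    (hE : ∀ j, algebraMap k₀ k (E₀.coeff j) = E.coeff j) (m : ℕ) :
    IsTraceNondegenerate k (words E m) := by
  intro f hf p q
  rw [← Module.forall_dual_apply_eq_zero_iff k₀]
  intro l
  obtain ⟨f₀, hf₀⟩ := exists_restrict_dual hE f l
  obtain ⟨g, hg⟩ := exists_extend_dual hE (f₀ ∘ₗ (transposeHom E₀).toLinearMap)
  have h := congr_arg l (hf g)
  have h2 (i j : Fin m → Option (Fin n)) : l (f (words E m i j) * g (words E m j i))
      = l (f (words E m i j)) * l (f (words E m i j)) := by
    rw [hg, ← Algebra.commutes, ← Algebra.smul_def, map_smul, smul_eq_mul]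
    simp [transposeHom_words, hf₀]
  simp only [map_sum, h2, map_zero] at h
  rw [Finset.sum_eq_zero_iff_of_nonneg
    fun i _ => Finset.sum_nonneg fun j _ => mul_self_nonneg _] at h
  have h3 := h p (Finset.mem_univ p)
  rw [Finset.sum_eq_zero_iff_of_nonneg fun j _ => mul_self_nonneg _] at h3
  exact mul_self_eq_zero.mp (h3 q (Finset.mem_univ q))

end SL

end BaseChange

/-- The form with prescribed coefficients. -/
noncomputable def Form.ofCoeff {k : Type*} [Field k] {n N : ℕ} (c : (Fin N → Fin n) → k) :
    Form k n N :=
  PiTensorProduct.lift (∑ j, c j •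
    (MultilinearMap.mkPiAlgebra k (Fin N) k).compLinearMap fun t => LinearMap.proj (j t))

theorem Form.coeff_ofCoeff {k : Type*} [Field k] {n N : ℕ} (c : (Fin N → Fin n) → k)
    (i : Fin N → Fin n) : (Form.ofCoeff c).coeff i = c i := by
  have h (j : Fin N → Fin n) :
      ∏ t, (Pi.single (i t) 1 : Fin n → k) (j t) = if j = i then 1 else 0 := by
    simp only [Pi.single_apply]
    rw [Finset.prod_ite_zero]
    simp [funext_iff]
  simp [Form.ofCoeff, Form.coeff, h]

theorem SL.isCosemisimple {k : Type*} [Field k] [CharZero k] {n N : ℕ} (E : Form k n N)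
    (hE : IsOrderable (IntermediateField.adjoin ℚ (Set.range E.coeff))) :
    IsCosemisimple k (SL E) := by
  obtain ⟨_, _⟩ := hE
  let E₀ : Form (IntermediateField.adjoin ℚ (Set.range E.coeff)) n N :=
    Form.ofCoeff fun j => ⟨E.coeff j, IntermediateField.subset_adjoin _ _ ⟨j, rfl⟩⟩
  refine isCosemisimple_of_isTraceNondegenerate (isCorep_words E)
    (isTraceNondegenerate_words (E₀ := E₀) fun j => ?_) ?_
  · rw [Form.coeff_ofCoeff]
    rfl
  · rw [eq_top_iff]
    rintro x -
    obtain ⟨m, hm⟩ := exists_mem_coeffSpan_words x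
    exact Submodule.mem_iSup_of_mem m hm

/-! ### Unitarizability of corepresentations -/

section Unitarizable

variable {C : Type v} [AddCommGroup C] [Module ℂ C] {ι κ : Type*}

/-- The values of a linear form on the coefficients of a matrix, as a vector. -/
noncomputable def coeffValues (u : Matrix ι ι C) :
    Module.Dual ℂ C →ₗ[ℂ] EuclideanSpace ℂ (ι × ι) :=
  (WithLp.linearEquiv 2 ℂ (ι × ι → ℂ)).symm.toLinearMap ∘ₗ
    LinearMap.pi fun p => Module.Dual.eval ℂ C (u p.1 p.2)

theorem inner_coeffValues [Fintype ι] (u : Matrix ι ι C) (f g : Module.Dual ℂ C) :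
    inner ℂ (coeffValues u f) (coeffValues u g)
      = ∑ i, ∑ j, star (f (u i j)) * g (u i j) := by
  rw [PiLp.inner_apply, Fintype.sum_prod_type]
  simp [coeffValues, mul_comm]

theorem apply_eq_zero_of_coeffValues {u : Matrix ι ι C} {f : Module.Dual ℂ C}
    (hf : coeffValues u f = 0) {y : C} (hy : y ∈ coeffSpan ℂ u) : f y = 0 := by
  have hle : coeffSpan ℂ u ≤ LinearMap.ker f := by
    refine Submodule.span_le.mpr ?_
    rintro _ ⟨p, rfl⟩
    exact congr_arg (fun v : EuclideanSpace ℂ (ι × ι) => v p) hf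
  exact hle hy

variable [Coalgebra ℂ C] [Fintype ι] [DecidableEq ι] [Fintype κ] [DecidableEq κ]

/-- Convolution by g on the left is left multiplication by the matrix g(u), whose Hilbert–Schmidt
adjoint is left multiplication by g(u)*, and g(u)* = g'(u). -/
theorem IsCorep.inner_conv {u : Matrix ι ι C} (hu : IsCorep ℂ u) {g g' : Module.Dual ℂ C}
    (hg : ∀ i j, g' (u i j) = star (g (u j i))) (f h : Module.Dual ℂ C) :
    inner ℂ (coeffValues u f) (coeffValues u (conv g h))
      = inner ℂ (coeffValues u (conv g' f)) (coeffValues u h) := by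
  simp only [inner_coeffValues, hu.conv_apply, star_sum, star_mul, hg, star_star, Finset.mul_sum,
    Finset.sum_mul]
  have h1 : ∀ i, ∑ j, ∑ l, star (f (u i j)) * (g (u i l) * h (u l j))
      = ∑ l, ∑ j, star (f (u i j)) * (g (u i l) * h (u l j)) := fun i => Finset.sum_comm
  simp only [h1]
  rw [Finset.sum_comm]
  refine Finset.sum_congr rfl fun l _ => ?_
  rw [Finset.sum_comm]
  simp only [mul_assoc]

theorem IsCorep.map_conv {x : Matrix κ κ C} (hx : IsCorep ℂ x)
    (f g : Module.Dual ℂ C) : x.map (conv f g) = x.map f * x.map g := by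
  ext i j
  simp [hx.conv_apply, Matrix.mul_apply]

-- B B* is positive semidefinite with trivial kernel, hence invertible; being a nonnegative element
-- of a C*-algebra it is y* y, and G = y*.
open scoped ComplexOrder MatrixOrder Matrix.Norms.L2Operator in
theorem exists_isUnit_eq_mul_conjTranspose {ρ : Type*} [Fintype ρ] (B : Matrix κ ρ ℂ)
    (hB : ∀ v : κ → ℂ, Matrix.vecMul v B = 0 → v = 0) :
    ∃ G : GL κ ℂ, B * B.conjTranspose
      = (G : Matrix κ κ ℂ) * (G : Matrix κ κ ℂ).conjTranspose := by
  have hpos := Matrix.posSemidef_self_mul_conjTranspose B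
  have hunit : IsUnit (B * B.conjTranspose) := by
    rw [← Matrix.vecMul_injective_iff_isUnit]
    intro v w hvw
    rw [← sub_eq_zero]
    apply hB
    rw [← Matrix.vecMul_self_mul_conjTranspose_eq_zero, Matrix.sub_vecMul, sub_eq_zero]
    exact hvw
  obtain ⟨y, hy⟩ := CStarAlgebra.nonneg_iff_eq_star_mul_self.mp hpos.nonneg
  rw [hy] at hunit
  have hy' : IsUnit y.conjTranspose := by
    have := hunit
    rw [Matrix.isUnit_iff_isUnit_det, Matrix.det_mul] at this
    rw [Matrix.isUnit_iff_isUnit_det]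
    exact isUnit_of_mul_isUnit_left this
  refine ⟨hy'.unit, ?_⟩
  rw [hy, IsUnit.unit_spec, Matrix.conjTranspose_conjTranspose, Matrix.star_eq_conjTranspose]

/-- If the linear forms on the coefficients of `u` are closed under conjugate transposition, then
every corepresentation `x` with coefficients among those of `u` is conjugate to one for which
conjugate transposition is compatible with that of `u`. -/
theorem IsCorep.exists_unitarizing {u : Matrix ι ι C} (hu : IsCorep ℂ u) {x : Matrix κ κ C}
    (hx : IsCorep ℂ x) (hxu : ∀ i j, x i j ∈ coeffSpan ℂ u) :
    ∃ G : GL κ ℂ, ∀ g g' : Module.Dual ℂ C, (∀ i j, g' (u i j) = star (g (u j i))) →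
      x.map g * ((G : Matrix κ κ ℂ) * (G : Matrix κ κ ℂ).conjTranspose)
        = ((G : Matrix κ κ ℂ) * (G : Matrix κ κ ℂ).conjTranspose) * (x.map g').conjTranspose := by
  -- The range is the image of the dual algebra in matrices; the f s lift an orthonormal basis of
  -- it. Since the entries of x lie in the span of those of u, x(g) depends only on the values of g
  -- on u and expands along the x(f s).
  let w := stdOrthonormalBasis ℂ (LinearMap.range (coeffValues u))
  choose f hf using fun s => (w s).2
  have hexp (g : Module.Dual ℂ C) :
      x.map g = ∑ s, inner ℂ (coeffValues u (f s)) (coeffValues u g) • x.map (f s) := by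
    have h0 : coeffValues u
        (g - ∑ s, inner ℂ (coeffValues u (f s)) (coeffValues u g) • f s) = 0 := by
      have h1 := congr_arg Subtype.val (w.sum_repr' ⟨coeffValues u g, g, rfl⟩)
      simp only [Submodule.coe_sum, Submodule.coe_smul, Submodule.coe_inner, ← hf] at h1
      rw [map_sub, map_sum, sub_eq_zero]
      simp only [map_smul]
      exact h1.symm
    ext i j
    have := apply_eq_zero_of_coeffValues h0 (hxu i j)
    rw [LinearMap.sub_apply, sub_eq_zero] at this
    simpa [Matrix.sum_apply] using this
  -- The matrices x(f s) placed side by side, so that B B* is the sum of the x(f s) x(f s)*.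
  let B : Matrix κ (Fin (Module.finrank ℂ (LinearMap.range (coeffValues u))) × κ) ℂ :=
    Matrix.of fun p sq => f sq.1 (x p sq.2)
  have hB : B * B.conjTranspose = ∑ s, x.map (f s) * (x.map (f s)).conjTranspose := by
    ext i j
    simp [B, Matrix.mul_apply, Matrix.sum_apply, Fintype.sum_prod_type]
  obtain ⟨G, hG⟩ := exists_isUnit_eq_mul_conjTranspose B (fun v hv => by
    have hvs (s) : Matrix.vecMul v (x.map (f s)) = 0 := by
      ext q
      exact congr_fun hv (s, q)
    -- The identity is a combination of the x(f s), so a row vector killed by all of them is zero.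
    have h1 : x.map (counit : C →ₗ[ℂ] ℂ) = 1 := by
      ext i j
      simp [hx.counit_apply, Matrix.one_apply]
    have h2 := congr_arg (Matrix.vecMul v) (hexp counit)
    rw [h1, Matrix.vecMul_one] at h2
    rw [h2]
    simp [Matrix.vecMul_sum, Matrix.vecMul_smul, hvs])
  refine ⟨G, fun g g' hgg' => ?_⟩
  rw [← hG, hB, Finset.mul_sum, Finset.sum_mul]
  have hl (s) : x.map g * (x.map (f s) * (x.map (f s)).conjTranspose)
      = ∑ t, inner ℂ (coeffValues u (f t)) (coeffValues u (conv g (f s))) •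
        (x.map (f t) * (x.map (f s)).conjTranspose) := by
    rw [← mul_assoc, ← hx.map_conv, hexp (conv g (f s)), Finset.sum_mul]
    simp only [smul_mul_assoc]
  have hr (t) : x.map (f t) * (x.map (f t)).conjTranspose * (x.map g').conjTranspose
      = ∑ s, inner ℂ (coeffValues u (conv g' (f t))) (coeffValues u (f s)) •
        (x.map (f t) * (x.map (f s)).conjTranspose) := by
    rw [mul_assoc, ← Matrix.conjTranspose_mul, ← hx.map_conv, hexp (conv g' (f t)),
      Matrix.conjTranspose_sum, Finset.mul_sum]
    refine Finset.sum_congr rfl fun s _ => ?_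
    rw [Matrix.conjTranspose_smul, mul_smul_comm, ← inner_conj_symm, starRingEnd_apply, star_star]
  simp only [hl, hr]
  rw [Finset.sum_comm]
  refine Finset.sum_congr rfl fun t _ => Finset.sum_congr rfl fun s _ => ?_
  rw [hu.inner_conv hgg']

end Unitarizable

/-! ### The `*`-structure of `SL(E)` -/

/-- The conjugate of a complex algebra. -/
def ConjAlg (A : Type v) : Type v := A

namespace ConjAlg

variable (A : Type v) [Ring A] [Algebra ℂ A]

instance : Ring (ConjAlg A) := inferInstanceAs (Ring A)

noncomputable instance : Algebra ℂ (ConjAlg A) :=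
  ((algebraMap ℂ A).comp (starRingEnd ℂ)).toAlgebra' fun c x => Algebra.commutes (star c) (x : A)

/-- The identity map from the conjugate algebra. -/
def toAlg : ConjAlg A ≃+* A := RingEquiv.refl A

theorem toAlg_algebraMap (c : ℂ) :
    toAlg A (algebraMap ℂ (ConjAlg A) c) = algebraMap ℂ A (star c) := rfl

theorem toAlg_smul (c : ℂ) (x : ConjAlg A) : toAlg A (c • x) = star c • toAlg A x := by
  rw [Algebra.smul_def, map_mul, toAlg_algebraMap, ← Algebra.smul_def]

end ConjAlg

theorem ColInvariant.conjAlg {n N : ℕ} {E : Form ℂ n N} (hE : ∀ j, star (E.coeff j) = E.coeff j)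
    {A : Type*} [Ring A] [Algebra ℂ A] {b : Matrix (Fin n) (Fin n) A} (hb : ColInvariant E b) :
    ColInvariant E (b.map (ConjAlg.toAlg A).symm) := by
  intro i
  apply (ConjAlg.toAlg A).injective
  rw [map_sum]
  simp only [ConjAlg.toAlg_smul, hE, ← map_wordMatrix, RingEquiv.apply_symm_apply, map_one]
  exact hb i

theorem RowInvariant.conjAlg {n N : ℕ} {E : Form ℂ n N} (hE : ∀ j, star (E.coeff j) = E.coeff j)
    {A : Type*} [Ring A] [Algebra ℂ A] {b : Matrix (Fin n) (Fin n) A} (hb : RowInvariant E b) :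
    RowInvariant E (b.map (ConjAlg.toAlg A).symm) :=
  (hb.transpose.conjAlg hE).transpose

/-! ### The antipode reverses the coproduct -/

section AntipodeComul

variable {k : Type u} {A : Type v} [Field k] [Ring A] [HopfAlgebra k A] {ι : Type*} [Fintype ι]
  [DecidableEq ι] {x : Matrix ι ι A}

/-- Over A ⊗ A, both sides are entries of the inverse of the matrix Δ(x). -/
theorem IsCorep.comul_antipode (hx : IsCorep k x) (i j : ι) :
    comul (R := k) (antipode k (x i j)) = ∑ l, antipode k (x l j) ⊗ₜ[k] antipode k (x i l) := by
  have h1 : (x.map (antipode k)).map (Bialgebra.comulAlgHom k A)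
      * x.map (Bialgebra.comulAlgHom k A) = 1 := by
    rw [← Matrix.map_mul, hx.antipode_mul, Matrix.map_one _ (map_zero _) (map_one _)]
  have h2 : x.map (Bialgebra.comulAlgHom k A)
      * (Matrix.of fun i j => ∑ l, antipode k (x l j) ⊗ₜ[k] antipode k (x i l)) = 1 := by
    ext i j
    have hxS (p l : ι) : ∑ q, x p q * antipode k (x q l) = (1 : Matrix ι ι A) p l := by
      rw [← hx.mul_antipode, Matrix.mul_apply]
      rfl
    calc _ = ∑ q, ∑ p, ∑ l, (x i p * antipode k (x l j)) ⊗ₜ[k] (x p q * antipode k (x q l)) := by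
          rw [Matrix.mul_apply]
          simp only [Matrix.map_apply, Bialgebra.comulAlgHom_apply, hx.comul_apply,
            Matrix.of_apply, Finset.sum_mul_sum, Algebra.TensorProduct.tmul_mul_tmul]
      _ = ∑ p, ∑ l, (x i p * antipode k (x l j)) ⊗ₜ[k] (1 : Matrix ι ι A) p l := by
          rw [Finset.sum_comm]
          refine Finset.sum_congr rfl fun p _ => ?_
          rw [Finset.sum_comm]
          simp only [← TensorProduct.tmul_sum, hxS]
      _ = (1 : Matrix ι ι A) i j ⊗ₜ[k] 1 := by
          rw [← hxS, TensorProduct.sum_tmul]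
          refine Finset.sum_congr rfl fun p _ => ?_
          simp [Matrix.one_apply, TensorProduct.tmul_ite]
      _ = _ := by
          by_cases h : i = j <;> simp [h, Matrix.one_apply, Algebra.TensorProduct.one_def]
  have h3 := left_inv_eq_right_inv h1 h2
  exact congr_fun₂ h3 i j

end AntipodeComul

/-! ### Antipode identities in terms of the predicate `IsAntipode` -/

namespace IsAntipode

variable {k : Type u} {A : Type v} [Field k] [Ring A] [Bialgebra k A] {S : A →ₗ[k] A}

theorem map_mul (hS : IsAntipode k S) (x y : A) : S (x * y) = S y * S x :=
  let _ : HopfAlgebra k A := hS.hopfAlgebra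
  antipode_mul_antidistrib (R := k) x y

theorem map_one (hS : IsAntipode k S) : S 1 = 1 :=
  let _ : HopfAlgebra k A := hS.hopfAlgebra
  antipode_one (R := k)

theorem map_algebraMap (hS : IsAntipode k S) (c : k) :
    S (algebraMap k A c) = algebraMap k A c := by
  rw [Algebra.algebraMap_eq_smul_one, map_smul, hS.map_one]

variable {ι : Type*} [Fintype ι] [DecidableEq ι] {x : Matrix ι ι A}

theorem corep_mul (hS : IsAntipode k S) (hx : IsCorep k x) : x * x.map S = 1 :=
  let _ : HopfAlgebra k A := hS.hopfAlgebra
  IsCorep.mul_antipode hx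

theorem mul_corep (hS : IsAntipode k S) (hx : IsCorep k x) : x.map S * x = 1 :=
  let _ : HopfAlgebra k A := hS.hopfAlgebra
  IsCorep.antipode_mul hx

theorem comul_corep (hS : IsAntipode k S) (hx : IsCorep k x) (i j : ι) :
    comul (R := k) (S (x i j)) = ∑ l, S (x l j) ⊗ₜ[k] S (x i l) :=
  let _ : HopfAlgebra k A := hS.hopfAlgebra
  IsCorep.comul_antipode hx i j

end IsAntipode

namespace SL

variable {n N : ℕ} {E : Form ℂ n N}

/-- The antilinear ring automorphism `a_{ij} ↦ a_{ji}` of `SL(E)`, for a real form `E`. -/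
noncomputable def barHom (hE : ∀ j, star (E.coeff j) = E.coeff j) : SL E →+* SL E :=
  (ConjAlg.toAlg (SL E)).toRingHom.comp
    (ofInvariant ((rowInvariant_gen E).transpose.conjAlg hE)
      ((colInvariant_gen E).transpose.conjAlg hE)).toRingHom

variable (hE : ∀ j, star (E.coeff j) = E.coeff j)

@[simp]
theorem barHom_a (i j : Fin n) : barHom hE (a E i j) = a E j i := by
  change ConjAlg.toAlg (SL E) (ofInvariant _ _ _) = _
  rw [ofInvariant_a]
  rfl

@[simp]
theorem barHom_algebraMap (c : ℂ) :
    barHom hE (algebraMap ℂ (SL E) c) = algebraMap ℂ (SL E) (star c) := by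
  change ConjAlg.toAlg (SL E) (ofInvariant _ _ _) = _
  rw [AlgHom.commutes, ConjAlg.toAlg_algebraMap]

theorem barHom_smul (c : ℂ) (x : SL E) : barHom hE (c • x) = star c • barHom hE x := by
  rw [Algebra.smul_def, map_mul, barHom_algebraMap, ← Algebra.smul_def]

theorem barHom_words {m : ℕ} (i j : Fin m → Option (Fin n)) :
    barHom hE (words E m i j) = words E m j i := by
  have : (gen E).map (barHom hE) = (gen E).transpose := by
    ext i j
    simp
  rw [words, map_wordMatrix, augment_map, this, augment_transpose]
  rfl

variable {S : SL E →ₗ[ℂ] SL E}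

/-- The composite is multiplicative and fixes scalars, both of its reversals and both conjugations
cancelling; on generators, apply S ∘ `barHom` to a S(a) = 1 and use uniqueness of inverses. -/
theorem antipode_barHom_antipode_barHom (hS : IsAntipode ℂ S) (x : SL E) :
    S (barHom hE (S (barHom hE x))) = x := by
  have hgen := isCorep_gen E
  have h : (Matrix.of fun i j => S (barHom hE (S (a E j i)))) * (gen E).map S = 1 := by
    ext i j
    have := congr_arg (fun x => S (barHom hE x)) (congr_fun₂ (hS.corep_mul hgen) j i)
    simp only [Matrix.mul_apply, map_sum, map_mul, hS.map_mul, gen_apply,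
      Matrix.map_apply, barHom_a] at this
    rw [Matrix.mul_apply]
    refine this.trans ?_
    by_cases h : i = j <;> simp [h, Matrix.one_apply, eq_comm, hS.map_one]
  have h' := left_inv_eq_right_inv h (hS.mul_corep hgen)
  induction x using SL.induction with
  | algebraMap r => simp [hS.map_algebraMap]
  | gen i j =>
    rw [barHom_a]
    exact congr_fun₂ h' i j
  | add x y hx hy => simp only [map_add, hx, hy]
  | mul x y hx hy => simp only [map_mul, hS.map_mul, hx, hy]

/-- The `*`-ring structure `x ↦ S(x̄)` of `SL(E)`, for a real form `E`. -/
noncomputable abbrev starRing (hS : IsAntipode ℂ S) : StarRing (SL E) where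
  star x := S (barHom hE x)
  star_involutive := antipode_barHom_antipode_barHom hE hS
  star_mul x y := by rw [map_mul, hS.map_mul]
  star_add x y := by rw [map_add, map_add]

theorem starModule (hS : IsAntipode ℂ S) :
    letI := starRing hE hS
    StarModule ℂ (SL E) :=
  letI := starRing hE hS
  ⟨fun c x => by
    change S (barHom hE (c • x)) = star c • S (barHom hE x)
    rw [barHom_smul, map_smul]⟩

theorem comul_star (hS : IsAntipode ℂ S) (x : SL E) :
    letI := starRing hE hS
    haveI := starModule hE hS
    comul (R := ℂ) (star x) = star (comul (R := ℂ) x) := by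
  let := starRing hE hS
  have := starModule hE hS
  have hstar (x : SL E) : star x = S (barHom hE x) := rfl
  change comul (R := ℂ) (star x) = star (comul (R := ℂ) x)
  induction x using SL.induction with
  | algebraMap r =>
    rw [hstar, barHom_algebraMap, hS.map_algebraMap, Bialgebra.comul_algebraMap,
      Bialgebra.comul_algebraMap, Algebra.algebraMap_eq_smul_one, Algebra.algebraMap_eq_smul_one,
      star_smul, star_one]
  | gen i j =>
    rw [hstar, barHom_a, comul_a, star_sum]
    simp only [TensorProduct.star_tmul, hstar, barHom_a]
    exact hS.comul_corep (isCorep_gen E) j i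
  | add x y hx hy => rw [star_add, map_add, map_add, hx, hy, star_add]
  | mul x y hx hy => rw [star_mul, Bialgebra.comul_mul, Bialgebra.comul_mul, hx, hy, star_mul]

/-- The linear form `x ↦ conj (f x̄)`. -/
noncomputable def barDual (f : Module.Dual ℂ (SL E)) : Module.Dual ℂ (SL E) where
  toFun x := star (f (barHom hE x))
  map_add' x y := by simp
  map_smul' c x := by simp [barHom_smul]

theorem map_conj_apply {A B : Type*} [Ring A] [Algebra ℂ A] [Ring B] [Algebra ℂ B] {κ : Type*}
    [Fintype κ] (F G : Matrix κ κ ℂ) (x : Matrix κ κ A) (f : A →ₗ[ℂ] B) :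
    (F.map (algebraMap ℂ A) * x * G.map (algebraMap ℂ A)).map f
      = F.map (algebraMap ℂ B) * x.map f * G.map (algebraMap ℂ B) := by
  ext i j
  simp only [Matrix.map_apply, Matrix.mul_apply, map_sum, Finset.sum_mul]
  refine Finset.sum_congr rfl fun q _ => Finset.sum_congr rfl fun p _ => ?_
  rw [← Algebra.commutes, ← Algebra.commutes, ← Algebra.smul_def, ← Algebra.smul_def,
    ← Algebra.smul_def, ← Algebra.smul_def, map_smul, map_smul]

/-- Every corepresentation of `SL(E)`, for a real form `E`, is conjugate to one fixed by the
antilinear transposition. -/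
theorem exists_barHom_conj_eq {κ : Type*} [Fintype κ] [DecidableEq κ] {x : Matrix κ κ (SL E)}
    (hx : IsCorep ℂ x) : ∃ F : GL κ ℂ, ∀ i j,
      barHom hE (((F : Matrix κ κ ℂ).map (algebraMap ℂ (SL E)) * x *
        ((F⁻¹ : GL κ ℂ) : Matrix κ κ ℂ).map (algebraMap ℂ (SL E))) i j)
      = ((F : Matrix κ κ ℂ).map (algebraMap ℂ (SL E)) * x *
        ((F⁻¹ : GL κ ℂ) : Matrix κ κ ℂ).map (algebraMap ℂ (SL E))) j i := by
  -- The finitely many entries of x all lie in the span for the largest word length.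
  choose m hm using fun p : κ × κ => exists_mem_coeffSpan_words (x p.1 p.2)
  obtain ⟨G, hG⟩ := (isCorep_words E (Finset.univ.sup m)).exists_unitarizing hx fun i j =>
    coeffSpan_words_mono E (Finset.le_sup (Finset.mem_univ (i, j))) (hm (i, j))
  refine ⟨G⁻¹, fun i j => ?_⟩
  set y := ((G⁻¹ : GL κ ℂ) : Matrix κ κ ℂ).map (algebraMap ℂ (SL E)) * x *
    ((G⁻¹⁻¹ : GL κ ℂ) : Matrix κ κ ℂ).map (algebraMap ℂ (SL E)) with hy
  have hyf (f : Module.Dual ℂ (SL E)) : y.map f = (G⁻¹ : GL κ ℂ) * x.map f * (G : Matrix κ κ ℂ) := by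
    rw [hy, map_conj_apply]
    simp
  -- On words `barDual` is conjugate transposition; multiplying the intertwining relation for G G*
  -- by G⁻¹ on the left and its adjoint on the right makes y compatible with it.
  have hstar (f : Module.Dual ℂ (SL E)) : y.map f = (y.map (barDual hE f)).conjTranspose := by
    have h := hG f (barDual hE f) fun i j => by simp [barDual, barHom_words]
    have h1 : ((G⁻¹ : GL κ ℂ) : Matrix κ κ ℂ) * G = 1 := by
      rw [← Units.val_mul, inv_mul_cancel, Units.val_one]
    have h2 : (G : Matrix κ κ ℂ) * (G⁻¹ : GL κ ℂ) = 1 := by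
      rw [← Units.val_mul, mul_inv_cancel, Units.val_one]
    have h2' : (G : Matrix κ κ ℂ).conjTranspose * ((G⁻¹ : GL κ ℂ) : Matrix κ κ ℂ).conjTranspose
        = 1 := by
      rw [← Matrix.conjTranspose_mul, h1, Matrix.conjTranspose_one]
    rw [hyf, hyf, Matrix.conjTranspose_mul, Matrix.conjTranspose_mul]
    generalize ((G⁻¹ : GL κ ℂ) : Matrix κ κ ℂ) = F at *
    calc F * x.map f * (G : Matrix κ κ ℂ)
        = F * (x.map f * ((G : Matrix κ κ ℂ) * (G : Matrix κ κ ℂ).conjTranspose))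
            * F.conjTranspose := by
          simp only [mul_assoc, h2', mul_one]
      _ = (F * G) * (G : Matrix κ κ ℂ).conjTranspose * (x.map (barDual hE f)).conjTranspose
            * F.conjTranspose := by
          rw [h]
          simp only [mul_assoc]
      _ = _ := by
          rw [h1, one_mul, mul_assoc]
  rw [← sub_eq_zero, ← Module.forall_dual_apply_eq_zero_iff ℂ]
  intro f
  have := congr_fun₂ (hstar f) j i
  simp only [Matrix.map_apply, Matrix.conjTranspose_apply, barDual, LinearMap.coe_mk,
    AddHom.coe_mk, star_star] at this
  rw [map_sub, this, sub_self]

/-- Once y = F x F⁻¹ is exchanged with its transpose by `barHom`, its adjoint is S applied entrywise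
to y, that is F S(x) F⁻¹, which is the inverse of y. -/
theorem admitsCQGStructure (hE : ∀ j, star (E.coeff j) = E.coeff j) (hS : IsAntipode ℂ S) :
    letI : HopfAlgebra ℂ (SL E) := hS.hopfAlgebra
    AdmitsCQGStructure (SL E) := by
  refine ⟨starRing hE hS, starModule hE hS, comul_star hE hS, fun m x hx => ?_⟩
  let := starRing hE hS
  have hx' : IsCorep ℂ x := ⟨hx.1, hx.2⟩
  obtain ⟨F, hF⟩ := exists_barHom_conj_eq hE hx'
  refine ⟨F, ?_⟩
  have h1 : (F : Matrix (Fin m) (Fin m) ℂ).map (algebraMap ℂ (SL E))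
      * ((F⁻¹ : GL (Fin m) ℂ) : Matrix (Fin m) (Fin m) ℂ).map (algebraMap ℂ (SL E)) = 1 := by
    rw [← Matrix.map_mul, ← Units.val_mul, mul_inv_cancel, Units.val_one,
      Matrix.map_one _ (map_zero _) (map_one _)]
  have h2 : ((F⁻¹ : GL (Fin m) ℂ) : Matrix (Fin m) (Fin m) ℂ).map (algebraMap ℂ (SL E))
      * (F : Matrix (Fin m) (Fin m) ℂ).map (algebraMap ℂ (SL E)) = 1 := by
    rw [← Matrix.map_mul, ← Units.val_mul, inv_mul_cancel, Units.val_one,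
      Matrix.map_one _ (map_zero _) (map_one _)]
  set y := (F : Matrix (Fin m) (Fin m) ℂ).map (algebraMap ℂ (SL E)) * x *
    ((F⁻¹ : GL (Fin m) ℂ) : Matrix (Fin m) (Fin m) ℂ).map (algebraMap ℂ (SL E)) with hy
  have hstar : star y = (F : Matrix (Fin m) (Fin m) ℂ).map (algebraMap ℂ (SL E)) * x.map S *
      ((F⁻¹ : GL (Fin m) ℂ) : Matrix (Fin m) (Fin m) ℂ).map (algebraMap ℂ (SL E)) := by
    rw [← map_conj_apply, ← hy]
    ext i j
    change S (barHom hE (y j i)) = S (y i j)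
    rw [hF]
  generalize (F : Matrix (Fin m) (Fin m) ℂ).map (algebraMap ℂ (SL E)) = P at *
  generalize ((F⁻¹ : GL (Fin m) ℂ) : Matrix (Fin m) (Fin m) ℂ).map (algebraMap ℂ (SL E)) = R at *
  rw [Unitary.mem_iff, hstar, hy]
  constructor
  · calc P * x.map S * R * (P * x * R) = P * x.map S * (R * P) * x * R := by simp only [mul_assoc]
      _ = P * (x.map S * x) * R := by rw [h2, mul_one, mul_assoc P]
      _ = 1 := by rw [hS.mul_corep hx', mul_one, h1]
  · calc P * x * R * (P * x.map S * R) = P * x * (R * P) * x.map S * R := by simp only [mul_assoc]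
      _ = P * (x * x.map S) * R := by rw [h2, mul_one, mul_assoc P]
      _ = 1 := by rw [hS.corep_mul hx', mul_one, h1]

end SL

end Cosovereign

/-- The forms live on `V^{⊗ N}` with `V = k ^ n` and `N = M + 1 ≥ 2`. -/
theorem theorem5p3 {n M : ℕ} (hM : 2 ≤ M + 1) :
    (∀ (k : Type*) [Field k] (E : Cosovereign.Form k n (M + 1)),
      E.LeftNondegenerate → E.RightNondegenerate →
      -- the bialgebra `SL(E)` has an antipode `S`, so that it is a Hopf algebra
      ∃ (S : Cosovereign.SL E →ₗ[k] Cosovereign.SL E) (hS : Cosovereign.IsAntipode k S),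
        letI : HopfAlgebra k (Cosovereign.SL E) := hS.hopfAlgebra
        -- the antipode is bijective
        Function.Bijective (HopfAlgebra.antipode k : Cosovereign.SL E →ₗ[k] Cosovereign.SL E) ∧
        -- sovereign characters
        (∀ β : Fin n → kˣ,
          (∀ (i : Fin n) (j : Fin M → Fin n),
            E.coeff (Fin.snoc j i) = β i * E.coeff (Fin.cons i j)) →
          ∃ Φ : Cosovereign.SL E →ₐ[k] k, Cosovereign.IsSovereignCharacter Φ ∧
            ∀ i j, Φ (Cosovereign.SL.a E i j) = if i = j then (β i : k) else 0) ∧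
        -- cosemisimplicity
        (∀ [CharZero k],
          Cosovereign.IsOrderable (IntermediateField.adjoin ℚ (Set.range E.coeff)) →
          Cosovereign.IsCosemisimple k (Cosovereign.SL E))) ∧
    -- CQG structures over the complex numbers
    (∀ E : Cosovereign.Form ℂ n (M + 1),
      E.LeftNondegenerate → E.RightNondegenerate →
      (∀ j, ∃ r : ℝ, E.coeff j = (r : ℂ)) →
      ∃ (S : Cosovereign.SL E →ₗ[ℂ] Cosovereign.SL E) (hS : Cosovereign.IsAntipode ℂ S),
        letI : HopfAlgebra ℂ (Cosovereign.SL E) := hS.hopfAlgebra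
        Cosovereign.AdmitsCQGStructure (Cosovereign.SL E)) := by
  refine ⟨fun k _ E hl hr => ?_, fun E hl hr hE => ?_⟩
  · obtain ⟨S, hS, hbij⟩ := Cosovereign.SL.exists_antipode hl hr
    exact ⟨S, hS, hbij, fun β hβ => ⟨Cosovereign.SL.diagChar hβ,
      Cosovereign.SL.isSovereignCharacter_diagChar hl hS hbij hβ, Cosovereign.SL.diagChar_a hβ⟩,
      fun hE => Cosovereign.SL.isCosemisimple E hE⟩
  · obtain ⟨S, hS, -⟩ := Cosovereign.SL.exists_antipode hl hr
    refine ⟨S, hS, Cosovereign.SL.admitsCQGStructure (fun j => ?_) hS⟩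
    obtain ⟨r, hr⟩ := hE j
    rw [hr]
    exact Complex.conj_ofReal r
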